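/- Setting. Let $M$ be a real-analytic 3-manifold. A connection is a smooth $su(2)$-valued one-form $A=A^I\tau_I$ on $M$, $\tau_I=\frac i2\sigma_I$. An edge is an embedded regular analytic arc $e:[0,1]\to M$; its holonomy $h_e[A]\in SU(2)$ is $U(1)$, where $U'=A(\dot e)U$, $U(0)=1$. A graph $\gamma$ is a finite set of edges meeting each other at most in endpoints. $\mathrm{Cyl}$ is the C*-algebra generated, in the algebra of bounded functions of connections with the sup norm, by the cylindrical functions $A\mapsto g(h_{e_1}[A],\dots,h_{e_n}[A])$ with $e_1,\dots,e_n$ the edges of a graph and $g$ continuous on $SU(2)^n$; $\mathrm{Cyl}^\infty$ is the algebra generated by those with $g$ smooth. Let $\overline{\mathcal A}$ be the spectrum of $\mathrm{Cyl}$; elements of $\mathrm{Cyl}$ are identified with continuous functions on $\overline{\mathcal A}$. Surfaces $S$ are transversally oriented analytic surfaces in $M$ (semianalytic, possibly with boundary), and $f$ denotes a smooth $\mathbb R^3$-valued function (co-vector field) on $S$. A graph is adapted to $S$ if each of its edges meets $S$ only in endpoints or runs inside $S$. Let $l_P>0$. The derivation $X_{S,f}$ of $\mathrm{Cyl}^\infty$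 is determined by $$X_{S,f}[c]=\frac{i l_P^2}{2}\sum_{p\in S\cap\gamma}\ \sum_{e_p}\kappa(e_p)\,f_I(p)\,X^I_{e_p}[c]$$ for $c$ smooth cylindrical over a graph $\gamma$ adapted to $S$; the inner sum is over the edges at the vertex $p$, $\kappa(e_p)=1,-1,0$ if $e_p$ lies near $p$ above $S$, below $S$, or is tangential to $S$, and $X^I_{e_p}$ is the vector field $x\mapsto x\tau_I$ (if $e_p$ starts at $p$), respectively $x\mapsto-\tau_I x$ (if $e_p$ ends at $p$), on the factor $SU(2)$ belonging to $e_p$. $\mathfrak A$ is the *-algebra generated by $\mathrm{Cyl}$ and the elements $X_{S,f}=X_{S,f}^*$, with the relations $[X_{S,f},c]=X_{S,f}[c]$ ($c\in\mathrm{Cyl}^\infty$) and all linear relations holding between the derivations $X_{S,f}$. A *-representation $\pi$ of $\mathfrak A$ on a Hilbert space $\mathcal H$ consists of a unital *-representation of $\mathrm{Cyl}$ by bounded operators and densely defined symmetric operators $\pi(X_{S,f})$ such that these relations hold on all vectors for which all their terms are defined. Statement. Let $\pi$ be a *-representation of $\mathfrak A$ on $\mathcal H$. Then $\mathcal H$ is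 the Hilbert sum of a family of closed subspaces on which $\mathrm{Cyl}$ acts cyclically, with cyclic vectors $\Omega_\nu$. Let any such family $(\Omega_\nu)_\nu$ be given, and assume that $\mathfrak h:=\mathrm{span}\bigcup_\nu\pi(\mathrm{Cyl}^\infty)\Omega_\nu$ is contained in the domain of $\pi(X_{S,f})$ for all $S$ and $f$. Then there are: 1. a unique family of finite positive Baire measures $\mu_\nu$ on $\overline{\mathcal A}$ with $\int c\,d\mu_\nu=\langle\Omega_\nu,\pi(c)\Omega_\nu\rangle$ for all $c\in\mathrm{Cyl}$; 2. unique isometries $I_\nu:L^2(\overline{\mathcal A},\mu_\nu)\to\mathcal H$ with $I_\nu(c)=\pi(c)\Omega_\nu$ for $c\in \mathrm{Cyl}$; $\mathcal H$ is the Hilbert sum of their ranges, and $\pi(c)I_\nu(\psi)=I_\nu(c\psi)$; 3. a unique family of functions $F^{\iota\nu}_{S,f}\in L^2(\overline{\mathcal A},\mu_\iota)$ with $F^{\iota\nu}_{S,f}=P_\iota\,\pi(X_{S,f})I_\nu(1)$, $P_\iota=I_\iota^*$; and for all $c\in\mathrm{Cyl}^\infty$, $$\pi(X_{S,f})I_\nu(c)=I_\nu(X_{S,f}[c])+\sum_\iota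 I_\iota(cF^{\iota\nu}_{S,f}).$$ These satisfy, for all surfaces, co-vector fields and indices: (dom) $\sum_\iota\|F^{\iota\nu}_{S,f}\|^2<\infty$, i.e. $(F^{\iota\nu}_{S,f})_\iota\in\bigoplus_\iota L^2(\overline{\mathcal A},\mu_\iota)$. (rep) $F^{\iota\nu}_{S,f+f''}=F^{\iota\nu}_{S,f}+F^{\iota\nu}_{S,f''}$, and $$F^{\iota\nu}_{S,f}+F^{\iota\nu}_{S',f'}=F^{\iota\nu}_{S\setminus S',f}+F^{\iota\nu}_{S'\setminus S,f'}+F^{\iota\nu}_{S\cap S',f\pm f'}$$ whenever $S\setminus S'$, $S'\setminus S$ and $S\cap S'$ are surfaces (or empty), where $S\cap S'$ is oriented as $S$ and the sign at each point is the relative orientation of $S$ and $S'$ there. (div) For $c,c'\in\mathrm{Cyl}^\infty$, $$\langle X_{S,f}[c],c'\rangle_{L^2(\mu_\iota)}-\langle c,X_{S,f}[c']\rangle_{L^2(\mu_\iota)}=2i\,\langle c,\mathrm{Im}(F^{\iota\iota}_{S,f})\,c'\rangle_{L^2(\mu_\iota)},$$ and $F^{\nu\iota}_{S,f}\,d\mu_\nu=\overline{F^{\iota\nu}_{S,f}}\,d\mu_\iota$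 as complex measures for $\iota\neq\nu$. -/

import Mathlib

open scoped Manifold ContDiff Topology InnerProductSpace Matrix.Norms.Operator
open MeasureTheory Set Filter

universe u v w

noncomputable section

namespace LQG

/-! ### The group SU(2) and its Lie algebra -/

/-- Complex `2 × 2` matrices. -/
abbrev Mat : Type := Matrix (Fin 2) (Fin 2) ℂ

/-- The group `SU(2)`, with the topology induced from the matrices. -/
abbrev SU2 : Type := Matrix.specialUnitaryGroup (Fin 2) ℂ

/-- The basis `τ_I = (i/2) σ_I` of the Lie algebra `su(2)` (`σ_I` the Pauli matrices). -/
def tau : Fin 3 → Mat :=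
  ![(Complex.I / 2) • !![0, 1; 1, 0],
    (Complex.I / 2) • !![0, -Complex.I; Complex.I, 0],
    (Complex.I / 2) • !![1, 0; 0, -1]]

/-- The element `∑ a^I τ_I` of `su(2)`. -/
def suMat (a : Fin 3 → ℝ) : Mat := ∑ I, a I • tau I

instance : CompactSpace SU2 := by
  have hsub : (Matrix.specialUnitaryGroup (Fin 2) ℂ : Set Mat) ⊆
      Set.pi univ (fun _ => Set.pi univ (fun _ => Metric.closedBall (0 : ℂ) 1)) := by
    intro A hA i _ j _
    rw [mem_closedBall_zero_iff]
    exact entry_norm_bound_of_unitary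
      (Matrix.specialUnitaryGroup_le_unitaryGroup hA) i j
  have hcl : IsClosed (Matrix.specialUnitaryGroup (Fin 2) ℂ : Set Mat) := by
    have : (Matrix.specialUnitaryGroup (Fin 2) ℂ : Set Mat) =
        {A : Mat | star A * A = 1} ∩ ({A : Mat | A * star A = 1} ∩ {A : Mat | A.det = 1}) := by
      ext A
      simp only [SetLike.mem_coe, Matrix.mem_specialUnitaryGroup_iff, Matrix.mem_unitaryGroup_iff,
        mem_inter_iff, mem_ofPred_eq]
      constructor
      · rintro ⟨h1, h2⟩
        exact ⟨mul_eq_one_comm.mp h1, h1, h2⟩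
      · rintro ⟨_, h1, h2⟩
        exact ⟨h1, h2⟩
    rw [this]
    refine (isClosed_eq (by fun_prop) continuous_const).inter
      ((isClosed_eq (by fun_prop) continuous_const).inter
        (isClosed_eq (Continuous.matrix_det continuous_id) continuous_const))
  have hK : IsCompact (Set.pi univ (fun _ : Fin 2 =>
      Set.pi univ (fun _ : Fin 2 => Metric.closedBall (0 : ℂ) 1))) :=
    isCompact_univ_pi fun _ => isCompact_univ_pi fun _ => isCompact_closedBall 0 1
  exact isCompact_iff_compactSpace.mp (IsCompact.of_isClosed_subset hK hcl hsub)

/-- Smooth functions of `n` matrices. The smooth functions on the compact embedded submanifold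
`SU(2)^n` are exactly their restrictions. -/
def SmoothFn (n : ℕ) : Type := {G : (Fin n → Mat) → ℂ // ContDiff ℝ ∞ G}

/-- The restriction to `SU(2)^n`. -/
def SmoothFn.restrict {n : ℕ} (G : SmoothFn n) : C(Fin n → SU2, ℂ) where
  toFun h := G.1 (fun i => (h i : Mat))
  continuous_toFun := G.2.continuous.comp (by fun_prop)

/-- The action on the `i`-th argument of the left-invariant vector field of `τ_I`, whose value
at `x` is `x τ_I`. -/
def leftField {n : ℕ} (i : Fin n) (I : Fin 3) (G : (Fin n → Mat) → ℂ) (x : Fin n → Mat) : ℂ :=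
  fderiv ℝ G x (Pi.single i (x i * tau I))

/-- The action on the `i`-th argument of the right-invariant vector field of `τ_I`, whose value
at `x` is `-τ_I x`: it is the image of the left-invariant one under inversion. -/
def rightField {n : ℕ} (i : Fin n) (I : Fin 3) (G : (Fin n → Mat) → ℂ) (x : Fin n → Mat) : ℂ :=
  fderiv ℝ G x (Pi.single i (-(tau I * x i)))

lemma contDiff_leftField {n : ℕ} (i : Fin n) (I : Fin 3) {G : (Fin n → Mat) → ℂ}
    (hG : ContDiff ℝ ∞ G) : ContDiff ℝ ∞ (leftField i I G) := by
  refine (hG.fderiv_right (m := ∞) (by simp)).clm_apply ?_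
  exact (ContinuousLinearMap.single ℝ (fun _ : Fin n => Mat) i).contDiff.comp
    ((contDiff_apply ℝ Mat i).mul contDiff_const)

lemma contDiff_rightField {n : ℕ} (i : Fin n) (I : Fin 3) {G : (Fin n → Mat) → ℂ}
    (hG : ContDiff ℝ ∞ G) : ContDiff ℝ ∞ (rightField i I G) := by
  refine (hG.fderiv_right (m := ∞) (by simp)).clm_apply ?_
  exact (ContinuousLinearMap.single ℝ (fun _ : Fin n => Mat) i).contDiff.comp
    (contDiff_const.mul (contDiff_apply ℝ Mat i)).neg

section Geometry

variable (M : Type*) [TopologicalSpace M] [ChartedSpace (EuclideanSpace ℝ (Fin 3)) M]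
  [IsManifold (𝓡 3) ω M]

/-! ### Connections, edges, holonomies, graphs -/

/-- A smooth `su(2)`-valued one-form `A = A^I τ_I` on `M` (a connection of the trivial
`SU(2)`-bundle), given by its components `A^I`; smoothness is smoothness of the induced map on
the tangent bundle. -/
structure Connection where
  toFun : ∀ x : M, TangentSpace (𝓡 3) x →L[ℝ] (Fin 3 → ℝ)
  smooth' : ContMDiff (𝓡 3).tangent 𝓘(ℝ, Fin 3 → ℝ) ∞
    (fun v : TangentBundle (𝓡 3) M => toFun v.proj v.snd)

/-- The discrete topology: `Connection M →ᵇ ℂ` is then the algebra of all bounded functions of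
connections, with the supremum norm. -/
instance : TopologicalSpace (Connection M) := ⊥

instance : DiscreteTopology (Connection M) := ⟨rfl⟩

/-- An edge: an oriented regular real-analytic arc, embedded, with its two endpoints. Only the
values on `[0, 1]` matter. -/
structure Edge where
  toFun : ℝ → M
  analytic' : ∀ t ∈ Icc (0 : ℝ) 1, ContMDiffAt 𝓘(ℝ, ℝ) (𝓡 3) ω toFun t
  regular' : ∀ t ∈ Icc (0 : ℝ) 1, mfderiv 𝓘(ℝ, ℝ) (𝓡 3) toFun t ≠ 0
  injOn' : InjOn toFun (Icc 0 1)

variable {M}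

/-- The component `A^I(ė(t))` of the connection along the edge. -/
def Connection.along (A : Connection M) (e : Edge M) (t : ℝ) : Fin 3 → ℝ :=
  A.toFun (e.toFun t) (mfderiv 𝓘(ℝ, ℝ) (𝓡 3) e.toFun t (1 : ℝ))

/-- `U` solves the equation of parallel transport along `e`: `U' = A(ė) U`, `U(0) = 1`. -/
def IsParallelTransport (A : Connection M) (e : Edge M) (U : ℝ → SU2) : Prop :=
  U 0 = 1 ∧ ∀ t ∈ Icc (0 : ℝ) 1,
    HasDerivWithinAt (fun s => (U s : Mat)) (suMat (A.along e t) * (U t : Mat)) (Icc 0 1) t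

open Classical in
/-- The holonomy `h_e[A]`: the value at the end of `e` of the solution of the equation of parallel
transport (the path-ordered exponential, later factors on the left). -/
def holonomy (A : Connection M) (e : Edge M) : SU2 :=
  if h : ∃ U, IsParallelTransport A e U then h.choose 1 else 1

variable (M)

/-- A graph: finitely many edges which intersect each other at most in their endpoints. -/
structure Graph where
  n : ℕ
  edge : Fin n → Edge M
  disjoint' : ∀ i j, i ≠ j → ∀ s ∈ Icc (0 : ℝ) 1, ∀ t ∈ Icc (0 : ℝ) 1,
    (edge i).toFun s = (edge j).toFun t → (s = 0 ∨ s = 1) ∧ (t = 0 ∨ t = 1)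

variable {M}

/-- The function of connections `A ↦ g(h_{e_1}[A], …, h_{e_n}[A])`. -/
def cylFun (γ : Graph M) (g : C(Fin γ.n → SU2, ℂ)) : BoundedContinuousFunction (Connection M) ℂ :=
  BoundedContinuousFunction.ofNormedAddCommGroup
    (fun A => g (fun i => holonomy A (γ.edge i))) continuous_of_discreteTopology ‖g‖
    (fun _ => g.norm_coe_le_norm _)

variable (M)

/-- The C*-algebra `Cyl`: the closed *-algebra of bounded functions of connections generated by
the cylindrical functions. -/
def Cyl : StarSubalgebra ℂ (BoundedContinuousFunction (Connection M) ℂ) :=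
  (StarAlgebra.adjoin ℂ {c | ∃ (γ : Graph M) (g : C(Fin γ.n → SU2, ℂ)), c = cylFun γ g}).topologicalClosure

instance : IsClosed (Cyl M : Set (BoundedContinuousFunction (Connection M) ℂ)) :=
  StarSubalgebra.isClosed_topologicalClosure _

instance : CommCStarAlgebra (Cyl M) := StarSubalgebra.commCStarAlgebra (Cyl M)

variable {M}

/-- A cylindrical function as an element of `Cyl`. -/
def Cyl.of (γ : Graph M) (g : C(Fin γ.n → SU2, ℂ)) : Cyl M :=
  ⟨cylFun γ g, StarSubalgebra.le_topologicalClosure _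
    (StarAlgebra.subset_adjoin ℂ _ ⟨γ, g, rfl⟩)⟩

variable (M)

/-- The algebra `Cyl^∞` of smooth cylindrical functions. -/
def CylSmooth : Subalgebra ℂ (Cyl M) :=
  Algebra.adjoin ℂ {c | ∃ (γ : Graph M) (G : SmoothFn γ.n), c = Cyl.of γ G.restrict}

/-! ### Surfaces and fluxes -/

variable {M}

/-- Semianalytic subsets: locally a finite union of sets given by finitely many sign conditions
on analytic functions. -/
def IsSemianalytic (S : Set M) : Prop :=
  ∀ p : M, ∃ U : Set M, IsOpen U ∧ p ∈ U ∧ ∃ (k m : ℕ) (φ : Fin k → Fin m → M → ℝ)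
    (s : Fin k → Fin m → SignType),
    (∀ i j, ContMDiffOn (𝓡 3) 𝓘(ℝ, ℝ) ω (φ i j) U) ∧
    S ∩ U = {x ∈ U | ∃ i, ∀ j, SignType.sign (φ i j x) = s i j}

/-- `φ` and `ψ` have the same sign near `p`. -/
def SameSide (φ ψ : M → ℝ) (p : M) : Prop :=
  ∀ᶠ x in 𝓝 p, SignType.sign (φ x) = SignType.sign (ψ x)

variable (M)

/-- A (transversally) oriented analytic surface, possibly with (piecewise analytic) boundary, of
which any part may belong to it: a semianalytic set which near each of its points `p` is a
two-dimensional piece of a regular analytic surface `{side p = 0}`. The part `side p > 0` of a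
neighbourhood of `p` lies above the surface, the part `side p < 0` below it. -/
structure Surface where
  carrier : Set M
  side : M → M → ℝ
  semianalytic' : IsSemianalytic carrier
  analytic' : ∀ p ∈ carrier, ContMDiffAt (𝓡 3) 𝓘(ℝ, ℝ) ω (side p) p
  regular' : ∀ p ∈ carrier, mfderiv (𝓡 3) 𝓘(ℝ, ℝ) (side p) p ≠ 0
  side_eq_zero' : ∀ p ∈ carrier, ∀ᶠ x in 𝓝 p, x ∈ carrier → side p x = 0
  twoDim' : ∀ p ∈ carrier,
    p ∈ closure {q ∈ carrier | ∀ᶠ x in 𝓝 q, side p x = 0 → x ∈ carrier}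
  coherent' : ∀ p ∈ carrier, ∀ᶠ q in 𝓝 p, q ∈ carrier → SameSide (side q) (side p) q

variable {M}

/-- Smooth real co-vector fields `f^I` on the surface `S` (locally restrictions of smooth functions
on `M`). -/
structure CovectorField (S : Surface M) where
  toFun : S.carrier → Fin 3 → ℝ
  smooth' : ∀ p : S.carrier, ∃ g : M → Fin 3 → ℝ,
    ContMDiffAt (𝓡 3) 𝓘(ℝ, Fin 3 → ℝ) ∞ g p ∧ ∀ᶠ x in 𝓝 (p : M), ∀ hx, toFun ⟨x, hx⟩ = g x

instance (S : Surface M) : Add (CovectorField S) where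
  add f f' :=
    { toFun := f.toFun + f'.toFun
      smooth' := by
        intro p
        obtain ⟨g, hg, h⟩ := f.smooth' p
        obtain ⟨g', hg', h'⟩ := f'.smooth' p
        refine ⟨g + g', hg.add hg', ?_⟩
        filter_upwards [h, h'] with x h1 h2 hx
        simp [h1 hx, h2 hx] }

/-- The graph `γ` is adapted to `S`: every edge meets `S` only in its endpoints, unless it runs
inside `S`. -/
def Graph.Adapted (γ : Graph M) (S : Surface M) : Prop :=
  ∀ i, (∀ t ∈ Ioo (0 : ℝ) 1, (γ.edge i).toFun t ∉ S.carrier) ∨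
    (∀ t ∈ Ioo (0 : ℝ) 1, (γ.edge i).toFun t ∈ S.carrier)

open Classical in
/-- The number `κ`, for the germ along the filter `l` of a curve at a point `p` of `S`: `1` if the
curve lies above `S`, `-1` if it lies below, `0` otherwise (if it is tangential). -/
def kappa (S : Surface M) (p : M) (e : ℝ → M) (l : Filter ℝ) : ℝ :=
  if ∀ᶠ t in l, 0 < S.side p (e t) then 1
  else if ∀ᶠ t in l, S.side p (e t) < 0 then -1 else 0

open Classical in
/-- The function `κ(e_p) f_I(p)` at the beginning `p` of the edge `e`; zero if `p` is not on `S`. -/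
def coeffStart (S : Surface M) (f : CovectorField S) (e : Edge M) (I : Fin 3) : ℝ :=
  if h : e.toFun 0 ∈ S.carrier then kappa S (e.toFun 0) e.toFun (𝓝[>] 0) * f.toFun ⟨_, h⟩ I else 0

open Classical in
/-- The function `κ(e_p) f_I(p)` at the end `p` of the edge `e`; zero if `p` is not on `S`. -/
def coeffEnd (S : Surface M) (f : CovectorField S) (e : Edge M) (I : Fin 3) : ℝ :=
  if h : e.toFun 1 ∈ S.carrier then kappa S (e.toFun 1) e.toFun (𝓝[<] 1) * f.toFun ⟨_, h⟩ I else 0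

/-- The flux vector field on functions on `SU(2)^n` for a graph `γ` adapted to `S`:
`(i l_P² / 2) ∑_{p ∈ S ∩ γ} ∑_{e_p} κ(e_p) f_I X^I_{e_p}`. The double sum is written as a sum over
the edges `e` of `γ` and their two endpoints `p`; at the beginning of `e` the left-invariant field
occurs, at the end the right-invariant one. -/
def fluxOn (lP : ℝ) (γ : Graph M) (S : Surface M) (f : CovectorField S) (G : SmoothFn γ.n) :
    SmoothFn γ.n :=
  ⟨fun x => (Complex.I * (lP : ℂ) ^ 2 / 2) * ∑ i, ∑ I,
      ((coeffStart S f (γ.edge i) I : ℂ) * leftField i I G.1 x +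
        (coeffEnd S f (γ.edge i) I : ℂ) * rightField i I G.1 x), by
    refine contDiff_const.mul (ContDiff.sum fun i _ => ContDiff.sum fun I _ => ?_)
    exact (contDiff_const.mul (contDiff_leftField i I G.2)).add
      (contDiff_const.mul (contDiff_rightField i I G.2))⟩

/-- `IsFlux lP S f c d` means `X_{S,f}[c] = d`: the graph of the derivation `X_{S,f}` of `Cyl^∞`,
given by `fluxOn` on functions cylindrical over adapted graphs and extended by linearity and the
Leibniz rule. -/
inductive IsFlux (lP : ℝ) (S : Surface M) (f : CovectorField S) : Cyl M → Cyl M → Prop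
  | of (γ : Graph M) (hγ : γ.Adapted S) (G : SmoothFn γ.n) :
      IsFlux lP S f (Cyl.of γ G.restrict) (Cyl.of γ (fluxOn lP γ S f G).restrict)
  | add {c c' d d' : Cyl M} : IsFlux lP S f c d → IsFlux lP S f c' d' →
      IsFlux lP S f (c + c') (d + d')
  | smul (z : ℂ) {c d : Cyl M} : IsFlux lP S f c d → IsFlux lP S f (z • c) (z • d)
  | mul {c c' d d' : Cyl M} : IsFlux lP S f c d → IsFlux lP S f c' d' →
      IsFlux lP S f (c * c') (d * c' + c * d')

/-- The linear relation `∑ a_j X_{S_j,f_j} = 0` between derivations of `Cyl^∞`. -/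
def FluxRelation (lP : ℝ) {k : ℕ} (a : Fin k → ℂ) (S : Fin k → Surface M)
    (f : ∀ j, CovectorField (S j)) : Prop :=
  ∀ γ : Graph M, (∀ j, γ.Adapted (S j)) → ∀ G : SmoothFn γ.n,
    ∑ j, a j • Cyl.of γ (fluxOn lP γ (S j) (f j) G).restrict = 0

/-! ### Representations -/

variable (M)

/-- A *-representation on the Hilbert space `H` of the *-algebra `𝔄` generated by `Cyl` and the
derivations `X_{S,f}`, which are self-adjoint elements of `𝔄`. The defining relations of `𝔄` are
the relations of the C*-algebra `Cyl`, the commutation relations `[X_{S,f}, c] = X_{S,f}[c]`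
for `c` in `Cyl^∞`, and the linear relations between the derivations `X_{S,f}`. `Cyl` is represented
by bounded operators, the `X_{S,f}` by densely defined symmetric operators; no relation between
their domains is required, and relations hold on the vectors on which all terms are defined. -/
structure Representation (lP : ℝ) (H : Type*) [NormedAddCommGroup H] [InnerProductSpace ℂ H]
    [CompleteSpace H] where
  cyl : Cyl M →⋆ₐ[ℂ] (H →L[ℂ] H)
  flux : ∀ S : Surface M, CovectorField S → (H →ₗ.[ℂ] H)
  dense_flux : ∀ S f, Dense ((flux S f).domain : Set H)
  symmetric_flux : ∀ S f (φ ψ : (flux S f).domain),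
    ⟪flux S f φ, (ψ : H)⟫_ℂ = ⟪(φ : H), flux S f ψ⟫_ℂ
  commutator : ∀ (S : Surface M) (f : CovectorField S) (c d : Cyl M), IsFlux lP S f c d →
    ∀ (ψ : H) (hψ : ψ ∈ (flux S f).domain) (hcψ : cyl c ψ ∈ (flux S f).domain),
      flux S f ⟨cyl c ψ, hcψ⟩ - cyl c (flux S f ⟨ψ, hψ⟩) = cyl d ψ
  linear : ∀ {k : ℕ} (a : Fin k → ℂ) (S : Fin k → Surface M) (f : ∀ j, CovectorField (S j)),
    FluxRelation lP a S f → ∀ (ψ : H) (h : ∀ j, ψ ∈ (flux (S j) (f j)).domain),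
      ∑ j, a j • flux (S j) (f j) ⟨ψ, h j⟩ = 0

/-! ### The spectrum of `Cyl` and measures on it -/

/-- The space of generalized connections: the (Gelfand) spectrum of `Cyl`. -/
abbrev GenConnection : Type _ := WeakDual.characterSpace ℂ (Cyl M)

/-- The Baire σ-algebra of the spectrum: the smallest one for which all continuous real functions are
measurable. Measures on `GenConnection M` are therefore Baire measures. -/
instance baireSigmaAlgebra : MeasurableSpace (GenConnection M) :=
  ⨆ f : C(GenConnection M, ℝ), MeasurableSpace.comap f inferInstance

variable {M}

lemma measurable_real (f : C(GenConnection M, ℝ)) : Measurable f :=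
  Measurable.mono (comap_measurable f)
    (le_iSup (fun f : C(GenConnection M, ℝ) => MeasurableSpace.comap f inferInstance) f) le_rfl

/-- The Gelfand transform of `c`, a continuous function on the spectrum. -/
abbrev gelfand (c : Cyl M) : C(GenConnection M, ℂ) := WeakDual.gelfandTransform ℂ (Cyl M) c

lemma measurable_gelfand (c : Cyl M) : Measurable (gelfand c) := by
  have h := ((measurable_real ⟨fun x => (gelfand c x).re, by fun_prop⟩).complex_ofReal.add
    ((measurable_real ⟨fun x => (gelfand c x).im, by fun_prop⟩).complex_ofReal.mul_const
      Complex.I))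
  convert h using 1
  funext x
  exact (Complex.re_add_im _).symm

lemma memLp_gelfand_mul (μ : FiniteMeasure (GenConnection M)) (c : Cyl M)
    {F : GenConnection M → ℂ} (hF : MemLp F 2 (μ : Measure (GenConnection M))) :
    MemLp (fun x => gelfand c x * F x) 2 (μ : Measure (GenConnection M)) := by
  have hc : MemLp (gelfand c) ⊤ (μ : Measure (GenConnection M)) :=
    MemLp.of_bound (measurable_gelfand c).aestronglyMeasurable ‖gelfand c‖
      (Eventually.of_forall fun x => (gelfand c).norm_coe_le_norm x)
  exact MemLp.mul' hF hc

/-- The Hilbert space `L²` of a finite Baire measure on the spectrum. -/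
abbrev L2 (μ : FiniteMeasure (GenConnection M)) : Type _ :=
  Lp ℂ 2 (μ : Measure (GenConnection M))

/-- The element `c` of `Cyl`, as an element of `L²`. -/
def toL2 (μ : FiniteMeasure (GenConnection M)) (c : Cyl M) : L2 μ :=
  MemLp.toLp (gelfand c) (MemLp.of_bound (measurable_gelfand c).aestronglyMeasurable ‖gelfand c‖
      (Eventually.of_forall fun x => (gelfand c).norm_coe_le_norm x))

/-- The product `c F` in `L²`. -/
def mulL2 (μ : FiniteMeasure (GenConnection M)) (c : Cyl M) (F : L2 μ) : L2 μ :=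
  MemLp.toLp (fun x => gelfand c x * F x) (memLp_gelfand_mul μ c (Lp.memLp F))

/-! ### Cyclic decompositions and the domain assumption -/

section Decomposition

variable {lP : ℝ} {H : Type*} [NormedAddCommGroup H] [InnerProductSpace ℂ H] [CompleteSpace H]

/-- The closed subspace generated by `v` under `Cyl`. -/
def Representation.cyclicSubspace (π : Representation M lP H) (v : H) : Submodule ℂ H :=
  (Submodule.span ℂ (range fun c => π.cyl c v)).topologicalClosure

/-- `H` is the Hilbert sum of the subspaces on which `Cyl` acts cyclically, with cyclic
vectors `Ω ν`. -/
def Representation.IsCyclicDecomposition (π : Representation M lP H) {N : Type*} (Ω : N → H) :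
    Prop :=
  IsHilbertSum ℂ (fun ν => π.cyclicSubspace (Ω ν)) (fun ν => (π.cyclicSubspace (Ω ν)).subtypeₗᵢ)

/-- The subspace `𝔥`, the span of the `I_ν(Cyl^∞)`, where `I_ν(c) = π(c) Ω_ν`. -/
def Representation.smoothVectors (π : Representation M lP H) {N : Type*} (Ω : N → H) :
    Submodule ℂ H :=
  Submodule.span ℂ (⋃ ν, (fun c : Cyl M => π.cyl c (Ω ν)) '' (CylSmooth M : Set (Cyl M)))

/-- The assumption on domains: `𝔥` lies in the domain of all fluxes. -/
def Representation.DomainAssumption (π : Representation M lP H) {N : Type*} (Ω : N → H) : Prop :=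
  ∀ S f, π.smoothVectors Ω ≤ (π.flux S f).domain

end Decomposition

/-! ### The conditions on the family of functions -/

section Conditions

variable {N : Type*} (μ : N → FiniteMeasure (GenConnection M))

/-- Families `F^{ιν}_{S,f} ∈ L²(μ_ι)`; the arguments are `S`, `f`, `ι`, `ν` in this order. -/
abbrev FluxFunctions : Type _ := ∀ S : Surface M, CovectorField S → ∀ ι : N, N → L2 (μ ι)

variable {μ}

/-- (dom): `(F^{ιν}_{S,f})_ι` is an element of the Hilbert sum of the `L²(μ_ι)`. -/
def CondDom (F : FluxFunctions μ) : Prop :=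
  ∀ S f (ν : N), Memℓp (fun ι => F S f ι ν) 2

/-- (rep), first relation: additivity in the co-vector field. -/
def CondAdd (F : FluxFunctions μ) : Prop :=
  ∀ (S : Surface M) (f f'' : CovectorField S) (ι ν : N),
    F S (f + f'') ι ν = F S f ι ν + F S f'' ι ν

/-- `T` is, as an oriented surface, the subset `A` of `S`. -/
def IsPiece (T S : Surface M) (A : Set M) : Prop :=
  T.carrier = A ∧ A ⊆ S.carrier ∧ ∀ p ∈ A, SameSide (T.side p) (S.side p) p

/-- `ε` is the relative orientation of `S` and `S'` on their intersection. -/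
def IsRelativeOrientation (S S' : Surface M) (ε : M → ℝ) : Prop :=
  ∀ p ∈ S.carrier ∩ S'.carrier,
    (ε p = 1 ∧ SameSide (S'.side p) (S.side p) p) ∨
      (ε p = -1 ∧ SameSide (S'.side p) (fun x => -S.side p x) p)

/-- (rep), second relation: `F_{S,f} + F_{S',f'} = F_{S∖S',f} + F_{S'∖S,f'} + F_{S∩S',f±f'}`,
whenever `D = S∖S'`, `D' = S'∖S` and `T = S∩S'` are surfaces; `T` is oriented as `S`, and the sign is
the relative orientation of `S` and `S'` on `T`. -/
def CondSurfaces (F : FluxFunctions μ) : Prop :=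
  ∀ (S S' D D' T : Surface M) (ε : M → ℝ)
    (f : CovectorField S) (f' : CovectorField S') (g : CovectorField D) (g' : CovectorField D')
    (h : CovectorField T),
    IsPiece D S (S.carrier \ S'.carrier) → IsPiece D' S' (S'.carrier \ S.carrier) →
    IsPiece T S (S.carrier ∩ S'.carrier) → IsRelativeOrientation S S' ε →
    (∀ p hp hp', g.toFun ⟨p, hp⟩ = f.toFun ⟨p, hp'⟩) →
    (∀ p hp hp', g'.toFun ⟨p, hp⟩ = f'.toFun ⟨p, hp'⟩) →
    (∀ p hp hp' hp'', h.toFun ⟨p, hp⟩ = f.toFun ⟨p, hp'⟩ + ε p • f'.toFun ⟨p, hp''⟩) →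
    ∀ ι ν : N, F S f ι ν + F S' f' ι ν = F D g ι ν + F D' g' ι ν + F T h ι ν

/-- (div), first relation: `⟨X_{S,f}[c], c'⟩ - ⟨c, X_{S,f}[c']⟩ = 2i ⟨c, Im(F^{ιι}_{S,f}) c'⟩` in
`L²(μ_ι)`, for `c`, `c'` in `Cyl^∞`. -/
def CondDiv (lP : ℝ) (F : FluxFunctions μ) : Prop :=
  ∀ (S : Surface M) (f : CovectorField S) (ι : N) (c d c' d' : Cyl M),
    IsFlux lP S f c d → IsFlux lP S f c' d' →
    ⟪toL2 (μ ι) d, toL2 (μ ι) c'⟫_ℂ - ⟪toL2 (μ ι) c, toL2 (μ ι) d'⟫_ℂ =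
      2 * Complex.I * ∫ x, starRingEnd ℂ (gelfand c x) * (((F S f ι ι x).im : ℂ) * gelfand c' x)
        ∂(μ ι : Measure (GenConnection M))

/-- (div), second relation: `F^{νι}_{S,f} dμ_ν = conj(F^{ιν}_{S,f}) dμ_ι` for `ι ≠ ν`, as complex
measures. -/
def CondSymm (F : FluxFunctions μ) : Prop :=
  ∀ (S : Surface M) (f : CovectorField S) (ι ν : N), ι ≠ ν →
    (μ ν : Measure (GenConnection M)).withDensityᵥ (fun x => F S f ν ι x) =
      (μ ι : Measure (GenConnection M)).withDensityᵥ (fun x => starRingEnd ℂ (F S f ι ν x))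

end Conditions

end Geometry

end LQG

end

/-! By Gelfand duality `Cyl` is the algebra of continuous functions on its spectrum. A vector `Ω_ν`
defines the positive functional `c ↦ ⟨Ω_ν, π(c) Ω_ν⟩`, and the Riesz theorem represents it by a
finite measure, restricted here to the Baire sets (`exists_measure`). Baire sets are generated by
the π-system of cozero sets, whose indicators are limits of continuous functions; hence integrals
against continuous functions determine the measure, and also a complex measure with a density
(`setIntegral_eq_of_forall_integral_eq`). The map `c ↦ π(c) Ω_ν` preserves the `L²` norm, so it
extends to an isometry onto the cyclic subspace (`exists_isometry`, `range_isometry`).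

The commutation relation gives `π(X) π(c) Ω_ν = π(c) π(X) Ω_ν + π(X[c]) Ω_ν`. A flux on `𝔥` is
therefore known once the vectors `π(X) Ω_ν` are, and the `F^{ιν}` are their coordinates in the
Hilbert sum. Square summability of coordinates is (dom). (rep) holds because the coefficients `κ
f_I` satisfy the same linear relations at each germ of a curve (`coeffGerm_surfaces`). (div) is
symmetry of `π(X)` written in these coordinates: within one component it leaves `F - conj F`;
between two components orthogonality removes the derivation term. The latter identity first holds on
`Cyl^∞` and passes to `Cyl` by density (`dense_cylSmooth`, from Stone-Weierstrass on `SU(2)^n`).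

The geometric input is that `X_{S,f}` is defined on all of `Cyl^∞` (`exists_isFlux`). An analytic
arc enters and leaves a semianalytic set finitely often, so every graph can be subdivided into one
adapted to `S`; the holonomy of an edge is the ordered product of those of its parts. This
multiplicativity needs existence and uniqueness of parallel transport (`exists_transport`,
`transport_unique`). -/

noncomputable section

namespace LQG

/-! ### Finite Baire measures on compact spaces -/

section Baire

variable {X : Type*} [TopologicalSpace X]

/-- The sets on which a continuous real function is positive. -/
def cozeroSets (X : Type*) [TopologicalSpace X] : Set (Set X) :=
  range fun f : C(X, ℝ) => {x | 0 < f x}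

lemma isPiSystem_cozeroSets : IsPiSystem (cozeroSets X) := by
  rintro _ ⟨f, rfl⟩ _ ⟨g, rfl⟩ _
  exact ⟨f ⊓ g, by ext x; simp⟩

/-- The rays `(a, ∞)` generate the Borel sets of `ℝ`, and `{a < f}` is the cozero set of `f - a`.
This gives the Baire σ-algebra the form needed for π-λ induction. -/
lemma iSup_comap_eq_generateFrom_cozeroSets :
    (⨆ f : C(X, ℝ), MeasurableSpace.comap f inferInstance : MeasurableSpace X) =
      MeasurableSpace.generateFrom (cozeroSets X) := by
  apply le_antisymm
  · refine iSup_le fun f => ?_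
    rw [(BorelSpace.measurable_eq : (inferInstance : MeasurableSpace ℝ) = borel ℝ),
      borel_eq_generateFrom_Ioi, MeasurableSpace.comap_generateFrom]
    refine MeasurableSpace.generateFrom_mono ?_
    rintro _ ⟨_, ⟨a, rfl⟩, rfl⟩
    exact ⟨f - ContinuousMap.const X a, by ext x; simp⟩
  · refine MeasurableSpace.generateFrom_le ?_
    rintro _ ⟨f, rfl⟩
    exact le_iSup (fun f : C(X, ℝ) => MeasurableSpace.comap f inferInstance) f _
      ⟨Ioi 0, measurableSet_Ioi, rfl⟩

lemma iSup_comap_le_borel :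
    (⨆ f : C(X, ℝ), MeasurableSpace.comap f inferInstance : MeasurableSpace X) ≤ borel X := by
  refine iSup_le fun f => ?_
  rw [← measurable_iff_comap_le]
  let _ := borel X
  have : BorelSpace X := ⟨rfl⟩
  exact f.continuous.measurable

/-- Continuous functions with values in `[0, 1]` which increase to the indicator function of the
set `{0 < f}`. -/
def cutoff (f : C(X, ℝ)) (n : ℕ) : C(X, ℝ) where
  toFun x := min 1 (n * max (f x) 0)
  continuous_toFun := by fun_prop

lemma cutoff_mem (f : C(X, ℝ)) (n : ℕ) (x : X) : 0 ≤ cutoff f n x ∧ cutoff f n x ≤ 1 :=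
  ⟨le_min zero_le_one (by positivity), min_le_left _ _⟩

lemma tendsto_cutoff (f : C(X, ℝ)) (x : X) :
    Tendsto (fun n => cutoff f n x) atTop (𝓝 ({x | 0 < f x}.indicator 1 x)) := by
  by_cases hx : 0 < f x
  · rw [indicator_of_mem (by exact hx)]
    have h : ∀ᶠ n : ℕ in atTop, 1 ≤ (n : ℝ) * f x :=
      (tendsto_natCast_atTop_atTop.atTop_mul_const hx).eventually_ge_atTop 1
    refine tendsto_const_nhds.congr' ?_
    filter_upwards [h] with n hn
    simp [cutoff, hx.le, hn]
  · rw [indicator_of_notMem (by exact hx)]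
    simp [cutoff, max_eq_right (not_lt.mp hx)]

/-- The Riesz representation theorem on a compact Hausdorff space. -/
lemma exists_borel_measure [CompactSpace X] [T2Space X] (Λ : C(X, ℝ) →ₗ[ℝ] ℝ)
    (hΛ : ∀ f, 0 ≤ f → 0 ≤ Λ f) :
    ∃ ν : @Measure X (borel X), @IsFiniteMeasure X (borel X) ν ∧
      ∀ f : C(X, ℝ), @integral X ℝ _ _ (borel X) ν f = Λ f := by
  let _ := borel X
  have : BorelSpace X := ⟨rfl⟩
  let L : CompactlySupportedContinuousMap X ℝ →ₚ[ℝ] ℝ :=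
    PositiveLinearMap.mk₀
      { toFun := fun f => Λ f.toContinuousMap
        map_add' := fun f g => Λ.map_add _ _
        map_smul' := fun a f => Λ.map_smul _ _ }
      (fun f hf => hΛ _ hf)
  refine ⟨RealRMK.rieszMeasure L, ?_, fun f => ?_⟩
  · refine ⟨?_⟩
    exact IsCompact.measure_lt_top isCompact_univ
  · exact RealRMK.integral_rieszMeasure L
      ⟨f, HasCompactSupport.of_compactSpace f⟩

variable [mX : MeasurableSpace X]

lemma measurable_of_baire (hX : mX = ⨆ f : C(X, ℝ), MeasurableSpace.comap f inferInstance)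
    (f : C(X, ℝ)) : Measurable f := by
  subst hX
  exact Measurable.mono (comap_measurable f)
    (le_iSup (fun f : C(X, ℝ) => MeasurableSpace.comap f inferInstance) f) le_rfl

/-- The integral over a cozero set is a limit of integrals against continuous functions. -/
lemma tendsto_integral_cutoff (hX : mX = ⨆ f : C(X, ℝ), MeasurableSpace.comap f inferInstance)
    (μ : Measure X) {F : X → ℂ} (hF : Integrable F μ) (f : C(X, ℝ)) :
    Tendsto (fun n => ∫ x, (cutoff f n x : ℂ) * F x ∂μ) atTop (𝓝 (∫ x in {x | 0 < f x}, F x ∂μ)) := by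
  rw [← integral_indicator (measurableSet_lt measurable_const (measurable_of_baire hX f))]
  refine tendsto_integral_of_dominated_convergence (fun x => ‖F x‖) (fun n => ?_) hF.norm
    (fun n => ?_) ?_
  · exact ((measurable_of_baire hX (cutoff f n)).complex_ofReal.aestronglyMeasurable).mul hF.1
  · refine Eventually.of_forall fun x => ?_
    have h := cutoff_mem f n x
    rw [norm_mul, Complex.norm_real, Real.norm_of_nonneg h.1]
    exact mul_le_of_le_one_left (norm_nonneg _) h.2
  · refine Eventually.of_forall fun x => ?_
    have h := ((Complex.continuous_ofReal.tendsto _).comp (tendsto_cutoff f x)).mul_const (F x)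
    have e : {x | 0 < f x}.indicator F x = (({x | 0 < f x}.indicator 1 x : ℝ) : ℂ) * F x := by
      by_cases hx : 0 < f x
      · rw [indicator_of_mem (by exact hx), indicator_of_mem (by exact hx)]
        simp
      · rw [indicator_of_notMem (by exact hx), indicator_of_notMem (by exact hx)]
        simp
    rw [e]
    exact h

/-- Complex measures with densities with respect to Baire measures agree if they agree on continuous
functions. -/
theorem setIntegral_eq_of_forall_integral_eq
    (hX : mX = ⨆ f : C(X, ℝ), MeasurableSpace.comap f inferInstance)
    {μ ν : Measure X} {F G : X → ℂ} (hF : Integrable F μ) (hG : Integrable G ν)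
    (h : ∀ c : C(X, ℂ), ∫ x, c x * F x ∂μ = ∫ x, c x * G x ∂ν) {s : Set X}
    (hs : MeasurableSet s) : ∫ x in s, F x ∂μ = ∫ x in s, G x ∂ν := by
  -- The total integrals must agree beforehand, since the complement step subtracts from them.
  have huniv : ∫ x, F x ∂μ = ∫ x, G x ∂ν := by simpa using h 1
  induction s, hs using MeasurableSpace.induction_on_inter
    (hX.trans iSup_comap_eq_generateFrom_cozeroSets) isPiSystem_cozeroSets with
  | empty => simp
  | basic t ht =>
    obtain ⟨f, rfl⟩ := ht
    refine tendsto_nhds_unique (tendsto_integral_cutoff hX μ hF f) ?_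
    refine (tendsto_integral_cutoff hX ν hG f).congr fun n => ?_
    exact (h ⟨fun x => (cutoff f n x : ℂ), by fun_prop⟩).symm
  | compl t ht ih =>
    rw [setIntegral_compl ht hF, setIntegral_compl ht hG, ih, huniv]
  | iUnion g hd hm ih =>
    rw [integral_iUnion hm hd hF.integrableOn, integral_iUnion hm hd hG.integrableOn]
    simp_rw [ih]

/-- This is the case of densities `1`; finiteness allows the measures to be recovered from their
real values. -/
theorem finiteMeasure_eq_of_forall_integral_eq
    (hX : mX = ⨆ f : C(X, ℝ), MeasurableSpace.comap f inferInstance) {μ ν : FiniteMeasure X}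
    (h : ∀ c : C(X, ℂ), ∫ x, c x ∂(μ : Measure X) = ∫ x, c x ∂(ν : Measure X)) : μ = ν := by
  refine Subtype.ext (Measure.ext fun s hs => ?_)
  have := setIntegral_eq_of_forall_integral_eq hX (μ := μ) (ν := ν) (F := fun _ => 1)
    (G := fun _ => 1) (integrable_const _) (integrable_const _) (by simpa using h) hs
  simp only [integral_const, MeasurableSet.univ, measureReal_restrict_apply, univ_inter,
    Complex.real_smul, mul_one, Complex.ofReal_inj] at this
  exact (ENNReal.toReal_eq_toReal_iff' (μ.2.measure_univ_lt_top.trans_le' (measure_mono (subset_univ s))).ne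
    (ν.2.measure_univ_lt_top.trans_le' (measure_mono (subset_univ s))).ne).mp this

theorem ae_eq_zero_of_forall_integral_eq_zero
    (hX : mX = ⨆ f : C(X, ℝ), MeasurableSpace.comap f inferInstance) {μ : Measure X} {F : X → ℂ}
    (hF : Integrable F μ) (h : ∀ c : C(X, ℂ), ∫ x, c x * F x ∂μ = 0) : F =ᵐ[μ] 0 := by
  refine hF.ae_eq_zero_of_forall_setIntegral_eq_zero fun s hs _ => ?_
  have := setIntegral_eq_of_forall_integral_eq hX (μ := μ) (ν := μ) hF (integrable_zero X ℂ μ)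
    (by simpa using h) hs
  simpa using this

/-- The Riesz representation theorem for Baire measures on a compact Hausdorff space. -/
theorem exists_baire_measure [CompactSpace X] [T2Space X]
    (hX : mX = ⨆ f : C(X, ℝ), MeasurableSpace.comap f inferInstance)
    (Λ : C(X, ℝ) →ₗ[ℝ] ℝ) (hΛ : ∀ f, 0 ≤ f → 0 ≤ Λ f) :
    ∃ μ : FiniteMeasure X, ∀ f : C(X, ℝ), ∫ x, f x ∂(μ : Measure X) = Λ f := by
  have hle : mX ≤ borel X := hX.trans_le iSup_comap_le_borel
  obtain ⟨ν, hν, hint⟩ := exists_borel_measure Λ hΛ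
  -- Restricting the Borel measure to the Baire sets keeps the integrals of continuous functions,
  -- which are Baire measurable.
  refine ⟨⟨@Measure.trim X mX (borel X) ν hle, ?_⟩, fun f => ?_⟩
  · exact @isFiniteMeasure_trim X mX (borel X) ν hle hν
  · rw [← hint f]
    exact (@integral_trim _ _ _ _ mX (borel X) ν hle f
      (measurable_of_baire hX f).stronglyMeasurable).symm

end Baire

/-! ### Parallel transport in `SU(2)` -/

lemma star_tau (I : Fin 3) : star (tau I) = -tau I := by
  ext i j
  fin_cases I <;> fin_cases i <;> fin_cases j <;>
    simp [tau, Matrix.star_apply, Complex.ext_iff] <;> norm_num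

lemma trace_tau (I : Fin 3) : (tau I).trace = 0 := by
  fin_cases I <;> simp [tau, Matrix.trace_fin_two]

lemma star_suMat (a : Fin 3 → ℝ) : star (suMat a) = -suMat a := by
  simp [suMat, star_sum, star_tau, star_smul]

lemma trace_suMat (a : Fin 3 → ℝ) : (suMat a).trace = 0 := by
  simp [suMat, Matrix.trace_sum, Matrix.trace_smul, trace_tau]

lemma suMat_smul (r : ℝ) (a : Fin 3 → ℝ) : suMat (r • a) = r • suMat a := by
  simp [suMat, Finset.smul_sum, smul_smul]

lemma continuous_suMat : Continuous suMat := by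
  unfold suMat
  fun_prop

/-- A solution of `α' = φ B α` with values `B` in `su(2)` and a scalar factor `φ` stays in
`SU(2)`. -/
lemma mem_SU2_of_hasDerivWithinAt {B : ℝ → Mat} {φ : ℝ → ℝ} {α : ℝ → Mat}
    (hB : ∀ t ∈ Icc (0 : ℝ) 1, star (B t) = -B t) (hB' : ∀ t ∈ Icc (0 : ℝ) 1, (B t).trace = 0)
    (h0 : α 0 = 1)
    (hα : ∀ t ∈ Icc (0 : ℝ) 1, HasDerivWithinAt α (φ t • (B t * α t)) (Icc 0 1) t)
    {t : ℝ} (ht : t ∈ Icc (0 : ℝ) 1) : α t ∈ Matrix.specialUnitaryGroup (Fin 2) ℂ := by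
  have hconst : ∀ {E : Type} [NormedAddCommGroup E] [NormedSpace ℝ E] (g : ℝ → E),
      (∀ s ∈ Icc (0 : ℝ) 1, HasDerivWithinAt g 0 (Icc 0 1) s) → g t = g 0 := by
    intro E _ _ g hg
    refine constant_of_has_deriv_right_zero (fun s hs => (hg s hs).continuousWithinAt)
      (fun s hs => ?_) t ht
    exact (hg s ⟨hs.1, hs.2.le⟩).mono_of_mem_nhdsWithin (Icc_mem_nhdsGE_of_mem hs)
  have hentry : ∀ i j, ∀ s ∈ Icc (0 : ℝ) 1, HasDerivWithinAt (fun s => α s i j)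
      ((φ s : ℂ) * (B s i 0 * α s 0 j + B s i 1 * α s 1 j)) (Icc 0 1) s := by
    intro i j s hs
    refine ((hasDerivWithinAt_pi.mp (hasDerivWithinAt_pi.mp (hα s hs) i)) j).congr_deriv ?_
    change φ s • (B s * α s) i j = _
    rw [Matrix.mul_apply, Fin.sum_univ_two, Complex.real_smul]
  rw [Matrix.mem_specialUnitaryGroup_iff, Matrix.mem_unitaryGroup_iff']
  constructor
  · have hs : ∀ s ∈ Icc (0 : ℝ) 1, ∀ i j, star (B s i j) = -B s j i := fun s hs i j => by
      have := congrFun (congrFun (hB s hs) j) i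
      rwa [Matrix.star_apply, Matrix.neg_apply] at this
    ext i j
    -- The entries of `α* α` are constant: the derivative is `φ α* (B* + B) α = 0`.
    have := hconst (fun s => star (α s 0 i) * α s 0 j + star (α s 1 i) * α s 1 j) fun s hs' => by
      refine ((((hentry 0 i s hs').star).mul (hentry 0 j s hs')).add
        (((hentry 1 i s hs').star).mul (hentry 1 j s hs'))).congr_deriv ?_
      simp only [star_mul', star_add, hs s hs', Complex.star_def, Complex.conj_ofReal]
      ring
    rw [Matrix.mul_apply, Fin.sum_univ_two, Matrix.star_apply, Matrix.star_apply, this, h0]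
    rw [← Matrix.star_apply, ← Matrix.star_apply, ← Fin.sum_univ_two (fun k => star (1 : Mat) i k *
      (1 : Mat) k j), ← Matrix.mul_apply, star_one, one_mul]
  -- Liouville's formula: `(det α)' = φ tr(B) det α = 0`.
  · have := hconst (fun s => α s 0 0 * α s 1 1 - α s 0 1 * α s 1 0) fun s hs => by
      refine (((hentry 0 0 s hs).mul (hentry 1 1 s hs)).sub
        ((hentry 0 1 s hs).mul (hentry 1 0 s hs))).congr_deriv ?_
      have htr := hB' s hs
      rw [Matrix.trace_fin_two] at htr
      linear_combination (φ s * (α s 0 0 * α s 1 1 - α s 0 1 * α s 1 0)) * htr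
    rw [Matrix.det_fin_two, this, h0]
    simp

/-- Compactness of `SU(2)` provides a radius within which a truncated transport equation may be left
unchanged. -/
lemma exists_norm_SU2_le : ∃ R > 0, ∀ U : SU2, ‖(U : Mat)‖ ≤ R := by
  obtain ⟨R, hR⟩ := (isCompact_range (continuous_subtype_val (p := fun x : Mat =>
    x ∈ Matrix.specialUnitaryGroup (Fin 2) ℂ))).isBounded.exists_norm_le
  exact ⟨max R 1, by positivity, fun U => (hR _ ⟨U, rfl⟩).trans (le_max_left _ _)⟩

/-- The equation of parallel transport has a solution in `SU(2)`. -/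
theorem exists_transport {B : ℝ → Mat} (hc : ContinuousOn B (Icc 0 1))
    (hB : ∀ t ∈ Icc (0 : ℝ) 1, star (B t) = -B t) (hB' : ∀ t ∈ Icc (0 : ℝ) 1, (B t).trace = 0) :
    ∃ U : ℝ → SU2, U 0 = 1 ∧ ∀ t ∈ Icc (0 : ℝ) 1,
      HasDerivWithinAt (fun s => (U s : Mat)) (B t * (U t : Mat)) (Icc 0 1) t := by
  obtain ⟨R, hR0, hR⟩ := exists_norm_SU2_le
  -- The linear field `B x` is unbounded in `x`. Multiplied by a bump function equal to `1` on the
  -- ball of radius `R`, it becomes bounded and globally Lipschitz, so that one application of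
  -- Picard-Lindelöf covers `[0, 1]`. The solution stays in `SU(2)`, hence in that ball, and solves
  -- the original equation.
  let φ : ContDiffBump (0 : Mat) := ⟨R, R + 1, hR0, by linarith⟩
  let g : Mat → Mat := fun x => φ x • x
  have hg : ContDiff ℝ 1 g := φ.contDiff.smul contDiff_id
  have hgs : HasCompactSupport g := φ.hasCompactSupport.smul_right
  obtain ⟨K, hK⟩ := hg.lipschitzWith_of_hasCompactSupport hgs one_ne_zero
  obtain ⟨C, hC⟩ := hgs.exists_bound_of_continuous hg.continuous
  obtain ⟨b, hb⟩ := isCompact_Icc.exists_bound_of_continuousOn hc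
  have hb0 : 0 ≤ b := (norm_nonneg _).trans (hb 0 (by simp))
  have hC0 : 0 ≤ C := (norm_nonneg _).trans (hC 0)
  -- The speed is at most `b * C` and the time interval has length `1`, so the ball of radius `b *
  -- C` is never left.
  have hPL : IsPicardLindelof (fun t x => B t * g x) (⟨0, by simp⟩ : Icc (0 : ℝ) 1) (1 : Mat)
      ⟨b * C, by positivity⟩ 0 ⟨b * C, by positivity⟩ (Real.toNNReal b * K) := by
    refine ⟨fun t ht => ?_, fun x _ => hc.mul continuousOn_const, fun t ht x _ => ?_, by simp⟩
    · refine LipschitzWith.lipschitzOnWith (LipschitzWith.of_dist_le_mul fun x y => ?_)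
      rw [dist_eq_norm, ← mul_sub]
      refine (norm_mul_le _ _).trans ?_
      have h1 := hK.dist_le_mul x y
      rw [dist_eq_norm] at h1
      push_cast
      rw [Real.coe_toNNReal _ hb0, mul_assoc]
      exact mul_le_mul (hb t ht) h1 (norm_nonneg _) hb0
    · exact (norm_mul_le _ _).trans (mul_le_mul (hb t ht) (hC x) (norm_nonneg _) hb0)
  obtain ⟨α, h0, hα⟩ := hPL.exists_eq_forall_mem_Icc_hasDerivWithinAt₀
  have hmem : ∀ t ∈ Icc (0 : ℝ) 1, α t ∈ Matrix.specialUnitaryGroup (Fin 2) ℂ := fun t ht =>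
    mem_SU2_of_hasDerivWithinAt (φ := fun t => φ (α t)) hB hB' h0
      (fun s hs => (hα s hs).congr_deriv (mul_smul_comm _ _ _)) ht
  classical
  let U : ℝ → SU2 := fun t => if h : t ∈ Icc (0 : ℝ) 1 then ⟨α t, hmem t h⟩ else 1
  have hU : ∀ t ∈ Icc (0 : ℝ) 1, (U t : Mat) = α t := fun t ht => by simp only [U, dif_pos ht]
  refine ⟨U, Subtype.ext ((hU 0 (by simp)).trans h0), fun t ht => ?_⟩
  refine HasDerivWithinAt.congr_of_mem ?_ hU ht
  convert hα t ht using 1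
  have : φ (α t) = 1 := φ.one_of_mem_closedBall (by
    simpa [φ] using hR ⟨α t, hmem t ht⟩)
  simp [g, this, hU t ht]

/-- Solutions of a linear matrix differential equation are unique. -/
theorem transport_unique {B : ℝ → Mat} (hc : ContinuousOn B (Icc 0 1)) {α β : ℝ → Mat}
    (hα : ∀ t ∈ Icc (0 : ℝ) 1, HasDerivWithinAt α (B t * α t) (Icc 0 1) t)
    (hβ : ∀ t ∈ Icc (0 : ℝ) 1, HasDerivWithinAt β (B t * β t) (Icc 0 1) t) (h0 : α 0 = β 0) :
    EqOn α β (Icc 0 1) := by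
  obtain ⟨b, hb⟩ := isCompact_Icc.exists_bound_of_continuousOn hc
  have hb0 : 0 ≤ b := (norm_nonneg _).trans (hb 0 (by simp))
  have hr : ∀ {γ : ℝ → Mat}, (∀ t ∈ Icc (0 : ℝ) 1, HasDerivWithinAt γ (B t * γ t) (Icc 0 1) t) →
      ∀ t ∈ Ico (0 : ℝ) 1, HasDerivWithinAt γ (B t * γ t) (Ici t) t := fun h t ht =>
    (h t ⟨ht.1, ht.2.le⟩).mono_of_mem_nhdsWithin (Icc_mem_nhdsGE_of_mem ht)
  refine ODE_solution_unique_of_mem_Icc_right (v := fun t x => B t * x) (s := fun _ => univ)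
    (K := Real.toNNReal b) (fun t ht => ?_) (fun t ht => (hα t ht).continuousWithinAt) (hr hα)
    (fun _ _ => mem_univ _) (fun t ht => (hβ t ht).continuousWithinAt) (hr hβ)
    (fun _ _ => mem_univ _) h0
  refine LipschitzWith.lipschitzOnWith (LipschitzWith.of_dist_le_mul fun x y => ?_)
  rw [dist_eq_norm, dist_eq_norm, ← mul_sub, Real.coe_toNNReal _ hb0]
  exact (norm_mul_le _ _).trans (mul_le_mul_of_nonneg_right (hb t ⟨ht.1, ht.2.le⟩) (norm_nonneg _))

/-! ### Parallel transport along edges and their pieces -/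

section Geometry

variable {M : Type*} [TopologicalSpace M] [ChartedSpace (EuclideanSpace ℝ (Fin 3)) M]

lemma Edge.continuousAt (e : Edge M) {t : ℝ} (ht : t ∈ Icc (0 : ℝ) 1) :
    ContinuousAt e.toFun t := (e.analytic' t ht).continuousAt

lemma Edge.mdifferentiableAt (e : Edge M) {t : ℝ} (ht : t ∈ Icc (0 : ℝ) 1) :
    MDifferentiableAt 𝓘(ℝ, ℝ) (𝓡 3) e.toFun t := (e.analytic' t ht).mdifferentiableAt (by simp)

lemma lineMap_mem_Icc {a b s : ℝ} (ha : 0 ≤ a) (hab : a < b) (hb : b ≤ 1)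
    (hs : s ∈ Icc (0 : ℝ) 1) : a + (b - a) * s ∈ Icc (0 : ℝ) 1 := by
  have h1 : 0 ≤ (b - a) * s := mul_nonneg (by linarith) hs.1
  have h2 : (b - a) * s ≤ b - a := mul_le_of_le_one_right (by linarith) hs.2
  constructor <;> linarith

lemma hasDerivAt_affine (a b s : ℝ) : HasDerivAt (fun s : ℝ => a + (b - a) * s) (b - a) s := by
  simpa using ((hasDerivAt_id s).const_mul (b - a)).const_add a

lemma mfderiv_comp_affine (e : ℝ → M) (a b s : ℝ)
    (he : MDifferentiableAt 𝓘(ℝ, ℝ) (𝓡 3) e (a + (b - a) * s)) (v : ℝ) :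
    mfderiv 𝓘(ℝ, ℝ) (𝓡 3) (fun s => e (a + (b - a) * s)) s v =
      mfderiv 𝓘(ℝ, ℝ) (𝓡 3) e (a + (b - a) * s) ((b - a) * v) := by
  have hd : MDifferentiableAt 𝓘(ℝ, ℝ) 𝓘(ℝ, ℝ) (fun s : ℝ => a + (b - a) * s) s :=
    (hasDerivAt_affine a b s).differentiableAt.mdifferentiableAt
  have h1 : mfderiv 𝓘(ℝ, ℝ) 𝓘(ℝ, ℝ) (fun s : ℝ => a + (b - a) * s) s v = (b - a) * v := by
    rw [mfderiv_eq_fderiv, (hasDerivAt_affine a b s).hasFDerivAt.fderiv]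
    exact mul_comm v (b - a)
  rw [← h1]
  exact congrArg (fun L : ℝ →L[ℝ] EuclideanSpace ℝ (Fin 3) => L v) (mfderiv_comp s he hd)

/-- The part of an edge between two values of the parameter, reparametrized by `[0, 1]`. -/
def Edge.piece (e : Edge M) (a b : ℝ) (ha : 0 ≤ a) (hab : a < b) (hb : b ≤ 1) : Edge M where
  toFun s := e.toFun (a + (b - a) * s)
  analytic' t ht := by
    refine (e.analytic' _ (lineMap_mem_Icc ha hab hb ht)).comp t ?_
    exact ContDiff.contMDiff (by fun_prop) t
  regular' t ht h := by
    have hm := lineMap_mem_Icc ha hab hb ht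
    apply e.regular' _ hm
    refine ContinuousLinearMap.ext fun v => ?_
    -- The vector is scaled by `(b - a)⁻¹` to cancel the factor from the chain rule.
    have h1 := mfderiv_comp_affine e.toFun a b t (e.mdifferentiableAt hm)
      ((b - a)⁻¹ * (show ℝ from v))
    rw [h, mul_inv_cancel_left₀ (sub_ne_zero.mpr hab.ne')] at h1
    exact h1.symm
  injOn' s hs t ht h := by
    have := e.injOn' (lineMap_mem_Icc ha hab hb hs) (lineMap_mem_Icc ha hab hb ht) h
    exact mul_left_cancel₀ (sub_ne_zero.mpr hab.ne') (add_left_cancel this)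

variable [IsManifold (𝓡 3) ω M]

/-- The velocity is the tangent map of `e` applied to the unit section of the tangent bundle of `ℝ`,
and `A` is continuous on the tangent bundle of `M`. The tangent map is taken within an open
neighbourhood of `t` on which `e` is analytic. -/
lemma Connection.continuousOn_along (A : Connection M) (e : Edge M) :
    ContinuousOn (A.along e) (Icc 0 1) := by
  intro t ht
  refine ContinuousAt.continuousWithinAt ?_
  obtain ⟨u, hu, hut⟩ := (contMDiffAt_iff_contMDiffOn_nhds (by simp)).mp (e.analytic' t ht)
  obtain ⟨s, hsu, hs, hts⟩ := mem_nhds_iff.mp hu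
  have hcont : ContinuousOn (tangentMapWithin 𝓘(ℝ, ℝ) (𝓡 3) e.toFun s)
      (Bundle.TotalSpace.proj ⁻¹' s) :=
    (hut.mono hsu).continuousOn_tangentMapWithin (by simp) hs.uniqueMDiffOn
  have hsec : Continuous (fun r : ℝ => (⟨r, 1⟩ : TangentBundle 𝓘(ℝ, ℝ) ℝ)) := by
    have := (tangentBundleModelSpaceHomeomorph 𝓘(ℝ, ℝ)).symm.continuous.comp
      (Continuous.prodMk_left (Y := ℝ) (X := ℝ) 1)
    exact this
  have h1 : ContinuousAt (fun r => A.toFun _ (tangentMapWithin 𝓘(ℝ, ℝ) (𝓡 3) e.toFun s ⟨r, 1⟩).2) t :=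
    (A.smooth'.continuous.continuousAt).comp
      ((hcont.continuousAt ((hs.preimage
        (FiberBundle.continuous_proj ℝ _)).mem_nhds (by exact hts))).comp hsec.continuousAt)
  refine h1.congr ?_
  filter_upwards [hs.mem_nhds hts] with r hr
  simp only [tangentMapWithin, Connection.along, mfderivWithin_of_isOpen hs hr]
  rfl

lemma Connection.exists_isParallelTransport (A : Connection M) (e : Edge M) :
    ∃ U, IsParallelTransport A e U :=
  exists_transport (continuous_suMat.comp_continuousOn (A.continuousOn_along e))
    (fun _ _ => star_suMat _) (fun _ _ => trace_suMat _)

/-- Uniqueness of transport makes the choice in the definition of `holonomy` immaterial. -/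
lemma IsParallelTransport.holonomy_eq {A : Connection M} {e : Edge M} {U : ℝ → SU2}
    (hU : IsParallelTransport A e U) : holonomy A e = U 1 := by
  have h : ∃ U, IsParallelTransport A e U := ⟨U, hU⟩
  rw [holonomy, dif_pos h]
  refine Subtype.ext (transport_unique (continuous_suMat.comp_continuousOn
    (A.continuousOn_along e)) h.choose_spec.2 hU.2 ?_ (right_mem_Icc.mpr zero_le_one))
  rw [h.choose_spec.1, hU.1]

lemma Connection.along_piece (A : Connection M) (e : Edge M) {a b : ℝ} (ha : 0 ≤ a) (hab : a < b)
    (hb : b ≤ 1) {s : ℝ} (hs : s ∈ Icc (0 : ℝ) 1) :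
    A.along (e.piece a b ha hab hb) s = (b - a) • A.along e (a + (b - a) * s) := by
  have h := mfderiv_comp_affine e.toFun a b s (e.mdifferentiableAt (lineMap_mem_Icc ha hab hb hs)) 1
  have h2 := (mfderiv 𝓘(ℝ, ℝ) (𝓡 3) e.toFun (a + (b - a) * s)).map_smul (b - a) (1 : ℝ)
  unfold Connection.along
  erw [h, h2, ContinuousLinearMap.map_smul]
  rfl

/-- The equation acts by left multiplication, so right multiplication by the constant `U(a)⁻¹`
preserves it and only restores the initial value `1`. -/
lemma IsParallelTransport.piece {A : Connection M} {e : Edge M} {U : ℝ → SU2}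
    (hU : IsParallelTransport A e U) {a b : ℝ} (ha : 0 ≤ a) (hab : a < b) (hb : b ≤ 1) :
    IsParallelTransport A (e.piece a b ha hab hb) (fun s => U (a + (b - a) * s) * (U a)⁻¹) := by
  refine ⟨by simp, fun s hs => ?_⟩
  have h1 := (hU.2 _ (lineMap_mem_Icc ha hab hb hs)).scomp s
    (hasDerivAt_affine a b s).hasDerivWithinAt (fun r hr => lineMap_mem_Icc ha hab hb hr)
  rw [A.along_piece e ha hab hb hs, suMat_smul]
  have h2 := h1.mul_const (((U a)⁻¹ : SU2) : Mat)
  refine h2.congr_deriv ?_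
  change _ = _ * ((U (a + (b - a) * s) : Mat) * (((U a)⁻¹ : SU2) : Mat))
  rw [smul_mul_assoc, smul_mul_assoc, mul_assoc]

lemma IsParallelTransport.holonomy_piece {A : Connection M} {e : Edge M}
    {U : ℝ → SU2} (hU : IsParallelTransport A e U) {a b : ℝ} (ha : 0 ≤ a) (hab : a < b)
    (hb : b ≤ 1) : U b = holonomy A (e.piece a b ha hab hb) * U a := by
  rw [(hU.piece ha hab hb).holonomy_eq]
  simp

end Geometry

/-! ### Subdivision of edges by semianalytic sets -/

/-- Unless it vanishes near `t`, an analytic function has no zeros in a punctured neighbourhood; its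
sign is then continuous, hence constant, on an interval to the right. -/
lemma eventually_sign_eq_right {g : ℝ → ℝ} {t : ℝ} (hg : AnalyticAt ℝ g t) :
    ∃ σ, ∀ᶠ s in 𝓝[>] t, SignType.sign (g s) = σ := by
  rcases hg.eventually_eq_zero_or_eventually_ne_zero with h | h
  · exact ⟨0, by filter_upwards [nhdsWithin_le_nhds h] with s hs; simp [hs]⟩
  · have h1 : ∀ᶠ s in 𝓝[>] t, g s ≠ 0 ∧ ContinuousAt g s := by
      filter_upwards [nhdsWithin_mono t (fun s (hs : s ∈ Ioi t) => ne_of_gt hs) h,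
        nhdsWithin_le_nhds hg.eventually_continuousAt] with s h1 h2 using ⟨h1, h2⟩
    obtain ⟨u, hu, hsub⟩ := mem_nhdsGT_iff_exists_Ioo_subset.mp h1
    have hmid : (t + u) / 2 ∈ Ioo t u := by
      have : t < u := hu
      constructor <;> linarith
    refine ⟨SignType.sign (g ((t + u) / 2)), ?_⟩
    filter_upwards [Ioo_mem_nhdsGT hu] with s hs
    have hc : ContinuousOn (fun s => SignType.sign (g s)) (Ioo t u) := fun r hr =>
      ((continuousAt_sign_of_ne_zero (hsub hr).1).comp (hsub hr).2).continuousWithinAt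
    exact isPreconnected_Ioo.constant hc hs hmid

lemma eventually_sign_eq_left {g : ℝ → ℝ} {t : ℝ} (hg : AnalyticAt ℝ g t) :
    ∃ σ, ∀ᶠ s in 𝓝[<] t, SignType.sign (g s) = σ := by
  have h : AnalyticAt ℝ (fun s => g (-s)) (-t) :=
    AnalyticAt.fun_comp (by simpa using hg) (by fun_prop)
  obtain ⟨σ, hσ⟩ := eventually_sign_eq_right h
  refine ⟨σ, ?_⟩
  have := tendsto_neg_nhdsLT (a := t) |>.eventually hσ
  simpa using this

/-- If a property is eventually constant on both sides of every point of `[0, 1]`, then it is constant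
on the open intervals of a finite partition. -/
lemma exists_partition {ι : Type*} (Q : ι → ℝ → Prop)
    (hr : ∀ t ∈ Icc (0 : ℝ) 1, ∀ᶠ u in 𝓝[>] t, ∀ i, (∀ s ∈ Ioo t u, Q i s) ∨ ∀ s ∈ Ioo t u, ¬ Q i s)
    (hl : ∀ t ∈ Icc (0 : ℝ) 1, ∀ᶠ u in 𝓝[<] t, ∀ i, (∀ s ∈ Ioo u t, Q i s) ∨ ∀ s ∈ Ioo u t, ¬ Q i s) :
    ∃ (k : ℕ) (t : Fin (k + 1) → ℝ), StrictMono t ∧ t 0 = 0 ∧ t (Fin.last k) = 1 ∧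
      ∀ (m : Fin k) (i : ι), (∀ s ∈ Ioo (t m.castSucc) (t m.succ), Q i s) ∨
        ∀ s ∈ Ioo (t m.castSucc) (t m.succ), ¬ Q i s := by
  classical
  have hloc : ∀ t : ℝ, ∃ a b : ℝ, a < t ∧ t < b ∧ (t ∈ Icc (0 : ℝ) 1 →
      (∀ i, (∀ s ∈ Ioo t b, Q i s) ∨ ∀ s ∈ Ioo t b, ¬ Q i s) ∧
        ∀ i, (∀ s ∈ Ioo a t, Q i s) ∨ ∀ s ∈ Ioo a t, ¬ Q i s) := by
    intro t
    by_cases ht : t ∈ Icc (0 : ℝ) 1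
    · obtain ⟨b, hb, hb'⟩ := ((hr t ht).and self_mem_nhdsWithin).exists
      obtain ⟨a, ha, ha'⟩ := ((hl t ht).and self_mem_nhdsWithin).exists
      exact ⟨a, b, ha', hb', fun _ => ⟨hb, ha⟩⟩
    · exact ⟨t - 1, t + 1, by linarith, by linarith, fun h => absurd h ht⟩
  choose a b ha hb hab using hloc
  obtain ⟨T, hT, hcov⟩ := isCompact_Icc.elim_nhds_subcover (fun t => Ioo (a t) (b t))
    (fun t (_ : t ∈ Icc (0 : ℝ) 1) => Ioo_mem_nhds (ha t) (hb t))
  -- The break points are the centres of a finite subcover together with both ends of each of its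
  -- intervals, as far as they lie in `[0, 1]`.
  let B : Finset ℝ := (insert 0 (insert 1 (T ∪ (T.image a ∪ T.image b)))).filter
    (fun t => t ∈ Icc (0 : ℝ) 1)
  have h0 : (0 : ℝ) ∈ B := by simp [B]
  have h1 : (1 : ℝ) ∈ B := by simp [B]
  have hB : ∀ t ∈ B, t ∈ Icc (0 : ℝ) 1 := fun t ht => (Finset.mem_filter.mp ht).2
  obtain ⟨k, hk⟩ : ∃ k, B.card = k + 1 := ⟨B.card - 1, by have := Finset.card_pos.mpr ⟨0, h0⟩; omega⟩
  let t := B.orderEmbOfFin hk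
  have htB : ∀ j, t j ∈ B := fun j => Finset.orderEmbOfFin_mem B hk j
  have hBt : ∀ x ∈ B, ∃ j, t j = x := fun x hx => by
    have : x ∈ range t := by rw [Finset.range_orderEmbOfFin]; exact hx
    exact this
  refine ⟨k, t, t.strictMono, ?_, ?_, ?_⟩
  · obtain ⟨j, hj⟩ := hBt 0 h0
    exact le_antisymm (hj ▸ t.monotone (Fin.zero_le j)) (hB _ (htB _)).1
  · obtain ⟨j, hj⟩ := hBt 1 h1
    exact le_antisymm (hB _ (htB _)).2 (hj.symm.trans_le (t.monotone (Fin.le_last j)))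
  · intro m i
    have hgap : ∀ x ∈ B, x ≤ t m.castSucc ∨ t m.succ ≤ x := by
      intro x hx
      obtain ⟨j, rfl⟩ := hBt x hx
      rcases le_or_gt j m.castSucc with h | h
      · exact Or.inl (t.monotone h)
      · exact Or.inr (t.monotone (Fin.castSucc_lt_iff_succ_le.mp h))
    have hlt : t m.castSucc < t m.succ := t.strictMono Fin.castSucc_lt_succ
    have hm0 := hB _ (htB m.castSucc)
    have hm1 := hB _ (htB m.succ)
    have hmid : (t m.castSucc + t m.succ) / 2 ∈ Icc (0 : ℝ) 1 :=
      ⟨by linarith [hm0.1, hm1.1], by linarith [hm0.2, hm1.2]⟩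
    -- The gap contains no break points. Hence it lies inside the covering interval of its midpoint,
    -- on one side of the centre `x`, where the property is constant.
    obtain ⟨x, hx, hxm⟩ := mem_iUnion₂.mp (hcov hmid)
    have hx01 : x ∈ Icc (0 : ℝ) 1 := hT x hx
    have hxB : x ∈ B := by
      simp only [B, Finset.mem_filter, Finset.mem_insert, Finset.mem_union]
      exact ⟨Or.inr (Or.inr (Or.inl hx)), hx01⟩
    rcases hgap x hxB with h | h
    · have hbx : t m.succ ≤ b x := by
        by_contra hcon
        rw [not_le] at hcon
        have hbB : b x ∈ B := by
          simp only [B, Finset.mem_filter, Finset.mem_insert, Finset.mem_union]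
          exact ⟨Or.inr (Or.inr (Or.inr (Or.inr (Finset.mem_image_of_mem b hx)))),
            by linarith [hx01.1, hb x], by linarith [hm1.2]⟩
        rcases hgap _ hbB with h' | h' <;> linarith [hxm.2]
      refine ((hab x hx01).1 i).imp ?_ ?_ <;>
        exact fun H s hs => H s ⟨h.trans_lt hs.1, hs.2.trans_le hbx⟩
    · have hax : a x ≤ t m.castSucc := by
        by_contra hcon
        rw [not_le] at hcon
        have haB : a x ∈ B := by
          simp only [B, Finset.mem_filter, Finset.mem_insert, Finset.mem_union]
          exact ⟨Or.inr (Or.inr (Or.inr (Or.inl (Finset.mem_image_of_mem a hx)))),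
            by linarith [hm0.1], by linarith [hx01.2, ha x]⟩
        rcases hgap _ haB with h' | h' <;> linarith [hxm.1]
      refine ((hab x hx01).2 i).imp ?_ ?_ <;>
        exact fun H s hs => H s ⟨hax.trans_lt hs.1, hs.2.trans_le h⟩

section Geometry

variable {M : Type*} [TopologicalSpace M] [ChartedSpace (EuclideanSpace ℝ (Fin 3)) M]

/-- An analytic arc lies inside or outside a semianalytic set, on either side of each of its
points. -/
lemma IsSemianalytic.eventually_mem_or_notMem {S : Set M} (hS : IsSemianalytic S) {e : ℝ → M} {t : ℝ}
    (he : ContMDiffAt 𝓘(ℝ, ℝ) (𝓡 3) ω e t) {l : Filter ℝ} (hl : l ≤ 𝓝 t)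
    (hsign : ∀ g : ℝ → ℝ, AnalyticAt ℝ g t → ∃ σ, ∀ᶠ s in l, SignType.sign (g s) = σ) :
    (∀ᶠ s in l, e s ∈ S) ∨ ∀ᶠ s in l, e s ∉ S := by
  obtain ⟨U, hU, htU, k, m, φ, σ, hφ, hSU⟩ := hS (e t)
  have hUe : ∀ᶠ s in l, e s ∈ U := hl (he.continuousAt (hU.mem_nhds htU))
  have hc : ∀ i j, ∃ τ, ∀ᶠ s in l, SignType.sign (φ i j (e s)) = τ := fun i j => by
    refine hsign _ ?_
    have h1 : ContMDiffAt 𝓘(ℝ, ℝ) 𝓘(ℝ, ℝ) ω (φ i j ∘ e) t :=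
      ((hφ i j).contMDiffAt (hU.mem_nhds htU)).comp t he
    exact h1.contDiffAt.analyticAt
  choose τ hτ using hc
  have hall : ∀ᶠ s in l, ∀ i j, SignType.sign (φ i j (e s)) = τ i j :=
    eventually_all.mpr fun i => eventually_all.mpr fun j => hτ i j
  have hiff : ∀ᶠ s in l, (e s ∈ S ↔ ∃ i, ∀ j, τ i j = σ i j) := by
    filter_upwards [hUe, hall] with s h1 h2
    have : e s ∈ S ↔ e s ∈ S ∩ U := by simp [h1]
    rw [this, hSU]
    simp only [mem_ofPred_eq, h1, true_and, h2]
  by_cases hp : ∃ i, ∀ j, τ i j = σ i j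
  · exact Or.inl (hiff.mono fun s hs => hs.mpr hp)
  · exact Or.inr (hiff.mono fun s hs h => hp (hs.mp h))

/-- Finiteness of the graph yields a single partition for all edges. All edges then have the same
number `k` of parts, and the parts are indexed by `Fin (n * k)`. -/
lemma Graph.exists_partition (γ : Graph M) (S : Surface M) :
    ∃ (k : ℕ) (t : Fin (k + 1) → ℝ), StrictMono t ∧ t 0 = 0 ∧ t (Fin.last k) = 1 ∧
      ∀ (m : Fin k) (i : Fin γ.n),
        (∀ s ∈ Ioo (t m.castSucc) (t m.succ), (γ.edge i).toFun s ∈ S.carrier) ∨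
        ∀ s ∈ Ioo (t m.castSucc) (t m.succ), (γ.edge i).toFun s ∉ S.carrier := by
  refine LQG.exists_partition (fun i s => (γ.edge i).toFun s ∈ S.carrier) (fun t ht => ?_)
    (fun t ht => ?_)
  · refine eventually_all.mpr fun i => ?_
    rcases S.semianalytic'.eventually_mem_or_notMem ((γ.edge i).analytic' t ht)
      (l := 𝓝[>] t) nhdsWithin_le_nhds (fun g => eventually_sign_eq_right) with h | h <;>
    obtain ⟨u, hu, hsub⟩ := mem_nhdsGT_iff_exists_Ioo_subset.mp h <;>
    filter_upwards [Ioo_mem_nhdsGT hu] with r hr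
    · exact Or.inl fun s hs => hsub ⟨hs.1, hs.2.trans hr.2⟩
    · exact Or.inr fun s hs => hsub ⟨hs.1, hs.2.trans hr.2⟩
  · refine eventually_all.mpr fun i => ?_
    rcases S.semianalytic'.eventually_mem_or_notMem ((γ.edge i).analytic' t ht)
      (l := 𝓝[<] t) nhdsWithin_le_nhds (fun g => eventually_sign_eq_left) with h | h <;>
    obtain ⟨u, hu, hsub⟩ := mem_nhdsLT_iff_exists_Ioo_subset.mp h <;>
    filter_upwards [Ioo_mem_nhdsLT hu] with r hr
    · exact Or.inl fun s hs => hsub ⟨hr.1.trans hs.1, hs.2⟩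
    · exact Or.inr fun s hs => hsub ⟨hr.1.trans hs.1, hs.2⟩

/-! ### Subdivision of graphs and multiplicativity of holonomies -/

section Subdivision

variable {k : ℕ} {t : Fin (k + 1) → ℝ}

lemma partition_nonneg (ht : StrictMono t) (h0 : t 0 = 0) (j : Fin (k + 1)) : 0 ≤ t j :=
  h0 ▸ ht.monotone (Fin.zero_le j)

lemma partition_le_one (ht : StrictMono t) (h1 : t (Fin.last k) = 1) (j : Fin (k + 1)) : t j ≤ 1 :=
  (ht.monotone (Fin.le_last j)).trans_eq h1

/-- The `m`-th part of an edge in a subdivision of `[0, 1]`. -/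
def Edge.part (e : Edge M) (ht : StrictMono t) (h0 : t 0 = 0) (h1 : t (Fin.last k) = 1) (m : Fin k) :
    Edge M :=
  e.piece (t m.castSucc) (t m.succ) (partition_nonneg ht h0 _) (ht Fin.castSucc_lt_succ)
    (partition_le_one ht h1 _)

lemma affine_mem_Ioo {a b s : ℝ} (hab : a < b) (hs : s ∈ Ioo (0 : ℝ) 1) :
    a + (b - a) * s ∈ Ioo a b :=
  ⟨by nlinarith [hs.1], by nlinarith [hs.2]⟩

/-- A parameter of a part which is an endpoint of the whole interval is an endpoint of the part. -/
lemma endpoint_of_affine_endpoint {a b s : ℝ} (ha : 0 ≤ a) (hab : a < b) (hb : b ≤ 1)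
    (hs : s ∈ Icc (0 : ℝ) 1) (h : a + (b - a) * s = 0 ∨ a + (b - a) * s = 1) : s = 0 ∨ s = 1 := by
  by_contra hcon
  rw [not_or] at hcon
  have := affine_mem_Ioo hab ⟨lt_of_le_of_ne hs.1 (Ne.symm hcon.1), lt_of_le_of_ne hs.2 hcon.2⟩
  rcases h with h | h <;> linarith [this.1, this.2]

/-- Distinct closed intervals of the partition can only share a break point, the end of the earlier
and the beginning of the later. -/
lemma endpoint_of_affine_eq (ht : StrictMono t) {m m' : Fin k} (hm : m < m') {s s' : ℝ}
    (hs : s ∈ Icc (0 : ℝ) 1) (hs' : s' ∈ Icc (0 : ℝ) 1)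
    (h : t m.castSucc + (t m.succ - t m.castSucc) * s =
      t m'.castSucc + (t m'.succ - t m'.castSucc) * s') : s = 1 ∧ s' = 0 := by
  have hlt : t m.castSucc < t m.succ := ht Fin.castSucc_lt_succ
  have hlt' : t m'.castSucc < t m'.succ := ht Fin.castSucc_lt_succ
  have hle : t m.succ ≤ t m'.castSucc := ht.monotone (by
    rw [Fin.le_def]; simpa using hm)
  constructor
  · by_contra hcon
    have : s < 1 := lt_of_le_of_ne hs.2 hcon
    nlinarith [hs'.1]
  · by_contra hcon
    have : 0 < s' := lt_of_le_of_ne hs'.1 (Ne.symm hcon)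
    nlinarith [hs.2]

/-- The graph obtained by subdividing all edges. -/
def Graph.subdivide (γ : Graph M) (ht : StrictMono t) (h0 : t 0 = 0) (h1 : t (Fin.last k) = 1) :
    Graph M where
  n := γ.n * k
  edge x := (γ.edge (finProdFinEquiv.symm x).1).part ht h0 h1 (finProdFinEquiv.symm x).2
  disjoint' x y hxy s hs r hr h := by
    obtain ⟨⟨i, m⟩, rfl⟩ := finProdFinEquiv.surjective x
    obtain ⟨⟨j, m'⟩, rfl⟩ := finProdFinEquiv.surjective y
    simp only [Equiv.symm_apply_apply, Edge.part, Edge.piece] at h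
    have hms := lineMap_mem_Icc (partition_nonneg ht h0 m.castSucc) (ht Fin.castSucc_lt_succ)
      (partition_le_one ht h1 m.succ) hs
    have hmr := lineMap_mem_Icc (partition_nonneg ht h0 m'.castSucc) (ht Fin.castSucc_lt_succ)
      (partition_le_one ht h1 m'.succ) hr
    by_cases hij : i = j
    · subst hij
      have heq := (γ.edge i).injOn' hms hmr h
      rcases lt_trichotomy m m' with hlt | rfl | hlt
      · obtain ⟨h2, h3⟩ := endpoint_of_affine_eq ht hlt hs hr heq
        exact ⟨Or.inr h2, Or.inl h3⟩
      · exact absurd rfl hxy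
      · obtain ⟨h2, h3⟩ := endpoint_of_affine_eq ht hlt hr hs heq.symm
        exact ⟨Or.inl h3, Or.inr h2⟩
    · have hend := γ.disjoint' i j hij _ hms _ hmr h
      exact ⟨endpoint_of_affine_endpoint (partition_nonneg ht h0 _) (ht Fin.castSucc_lt_succ)
        (partition_le_one ht h1 _) hs hend.1, endpoint_of_affine_endpoint (partition_nonneg ht h0 _)
          (ht Fin.castSucc_lt_succ) (partition_le_one ht h1 _) hr hend.2⟩

/-- The ordered product of the first `m` of the matrices belonging to the `i`-th edge. -/
def partialProd {n k : ℕ} (i : Fin n) (x : Fin (n * k) → Mat) : ℕ → Mat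
  | 0 => 1
  -- The default factor `1` does not occur in products of at most `k` factors.
  | m + 1 => (if h : m < k then x (finProdFinEquiv (i, ⟨m, h⟩)) else 1) * partialProd i x m

lemma contDiff_partialProd {n k : ℕ} (i : Fin n) (m : ℕ) :
    ContDiff ℝ ∞ (fun x : Fin (n * k) → Mat => partialProd i x m) := by
  induction m with
  | zero => exact contDiff_const
  | succ m ih =>
    simp only [partialProd]
    refine ContDiff.mul ?_ ih
    split_ifs with h
    · exact contDiff_apply ℝ Mat _
    · exact contDiff_const

/-- A function of the holonomies of the edges, as a function of the holonomies of their parts. -/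
def SmoothFn.subdivide {n : ℕ} (k : ℕ) (G : SmoothFn n) : SmoothFn (n * k) :=
  ⟨fun x => G.1 fun i => partialProd i x k,
    G.2.comp (contDiff_pi.mpr fun i => contDiff_partialProd i k)⟩

variable [IsManifold (𝓡 3) ω M]

/-- By induction the solution at the `m`-th break point is the product of the first `m` holonomies,
each new factor on the left. -/
lemma holonomy_eq_partialProd (γ : Graph M) (ht : StrictMono t) (h0 : t 0 = 0)
    (h1 : t (Fin.last k) = 1) (A : Connection M) (i : Fin γ.n) :
    (holonomy A (γ.edge i) : Mat) =
      partialProd i (fun x => (holonomy A ((γ.subdivide ht h0 h1).edge x) : Mat)) k := by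
  obtain ⟨U, hU⟩ := A.exists_isParallelTransport (γ.edge i)
  have key : ∀ m (hm : m < k + 1), (U (t ⟨m, hm⟩) : Mat) =
      partialProd i (fun x => (holonomy A ((γ.subdivide ht h0 h1).edge x) : Mat)) m := by
    intro m
    induction m with
    | zero =>
      intro hm
      have : t ⟨0, hm⟩ = 0 := h0
      rw [this, hU.1]
      rfl
    | succ m ih =>
      intro hm
      have hmk : m < k := by omega
      have := hU.holonomy_piece (partition_nonneg ht h0 (⟨m, hmk⟩ : Fin k).castSucc)
        (ht (Fin.castSucc_lt_succ (i := ⟨m, hmk⟩))) (partition_le_one ht h1 _)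
      rw [partialProd, dif_pos hmk, ← ih (by omega)]
      simp only [Graph.subdivide, Equiv.symm_apply_apply]
      exact congrArg Subtype.val this
  rw [hU.holonomy_eq, ← h1]
  exact key k (by omega)

lemma Cyl.of_subdivide (γ : Graph M) (ht : StrictMono t) (h0 : t 0 = 0)
    (h1 : t (Fin.last k) = 1) (G : SmoothFn γ.n) :
    Cyl.of γ G.restrict =
      Cyl.of (γ.subdivide ht h0 h1) (SmoothFn.restrict (n := γ.n * k) (G.subdivide k)) := by
  refine Subtype.ext (DFunLike.ext _ _ fun A => ?_)
  change G.1 (fun i => (holonomy A (γ.edge i) : Mat)) = G.1 _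
  exact congrArg G.1 (funext fun i => holonomy_eq_partialProd γ ht h0 h1 A i)

end Subdivision

/-! ### The domain of the derivations -/

variable [IsManifold (𝓡 3) ω M]

/-- Every smooth cylindrical function is cylindrical over a graph adapted to a given surface. -/
theorem exists_adapted (γ : Graph M) (G : SmoothFn γ.n) (S : Surface M) :
    ∃ (γ' : Graph M) (G' : SmoothFn γ'.n), γ'.Adapted S ∧
      Cyl.of γ G.restrict = Cyl.of γ' G'.restrict := by
  obtain ⟨k, t, ht, h0, h1, hS⟩ := γ.exists_partition S
  refine ⟨γ.subdivide ht h0 h1, G.subdivide k, fun x => ?_, Cyl.of_subdivide γ ht h0 h1 G⟩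
  refine (hS (finProdFinEquiv.symm x).2 (finProdFinEquiv.symm x).1).symm.imp ?_ ?_ <;>
    exact fun H s hs => H _ (affine_mem_Ioo (ht Fin.castSucc_lt_succ) hs)

/-- The empty graph is adapted to every surface; it takes care of the scalars in `exists_isFlux`. -/
lemma one_eq_of_adapted (S : Surface M) : ∃ (γ : Graph M) (G : SmoothFn γ.n), γ.Adapted S ∧
    (1 : Cyl M) = Cyl.of γ G.restrict :=
  ⟨⟨0, Fin.elim0, fun i => i.elim0⟩, ⟨fun _ => 1, contDiff_const⟩, fun i => i.elim0, rfl⟩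

/-- The derivation `X_{S,f}` is defined on all of `Cyl^∞`. -/
theorem exists_isFlux (lP : ℝ) (S : Surface M) (f : CovectorField S) {c : Cyl M}
    (hc : c ∈ CylSmooth M) : ∃ d, IsFlux lP S f c d := by
  induction hc using Algebra.adjoin_induction with
  | mem x hx =>
    obtain ⟨γ, G, rfl⟩ := hx
    obtain ⟨γ', G', ha, h⟩ := exists_adapted γ G S
    exact ⟨_, h ▸ IsFlux.of γ' ha G'⟩
  | algebraMap z =>
    obtain ⟨γ, G, ha, h⟩ := one_eq_of_adapted S
    rw [Algebra.algebraMap_eq_smul_one, h]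
    exact ⟨_, (IsFlux.of γ ha G).smul z⟩
  | add x y _ _ hx hy =>
    obtain ⟨d, hd⟩ := hx
    obtain ⟨d', hd'⟩ := hy
    exact ⟨_, hd.add hd'⟩
  | mul x y _ _ hx hy =>
    obtain ⟨d, hd⟩ := hx
    obtain ⟨d', hd'⟩ := hy
    exact ⟨_, hd.mul hd'⟩

lemma IsFlux.mem_cylSmooth {lP : ℝ} {S : Surface M} {f : CovectorField S} {c d : Cyl M}
    (h : IsFlux lP S f c d) : c ∈ CylSmooth M := by
  induction h with
  | of γ _ G => exact Algebra.subset_adjoin ⟨γ, G, rfl⟩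
  | add _ _ h1 h2 => exact add_mem h1 h2
  | smul z _ h => exact Subalgebra.smul_mem _ h z
  | mul _ _ h1 h2 => exact mul_mem h1 h2

end Geometry

/-! ### Smooth functions on `SU(2)^n` -/

/-- The algebra of smooth functions on `SU(2)^n`. -/
def smoothStarSubalgebra (n : ℕ) : StarSubalgebra ℂ C(Fin n → SU2, ℂ) where
  carrier := range SmoothFn.restrict
  mul_mem' := by
    rintro _ _ ⟨G, rfl⟩ ⟨G', rfl⟩
    exact ⟨⟨_, G.2.mul G'.2⟩, rfl⟩
  add_mem' := by
    rintro _ _ ⟨G, rfl⟩ ⟨G', rfl⟩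
    exact ⟨⟨_, G.2.add G'.2⟩, rfl⟩
  algebraMap_mem' z := ⟨⟨fun _ => z, contDiff_const⟩, rfl⟩
  star_mem' := by
    rintro _ ⟨G, rfl⟩
    exact ⟨⟨fun x => star (G.1 x), Complex.conjCLE.contDiff.comp G.2⟩, rfl⟩

/-- Stone-Weierstrass: the matrix entries are smooth and separate points. -/
lemma smoothStarSubalgebra_dense (n : ℕ) : (smoothStarSubalgebra n).topologicalClosure = ⊤ := by
  refine ContinuousMap.starSubalgebra_topologicalClosure_eq_top_of_separatesPoints _ ?_
  intro x y hxy
  obtain ⟨i, hi⟩ := Function.ne_iff.mp hxy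
  obtain ⟨j, k, hjk⟩ : ∃ j k, (x i : Mat) j k ≠ (y i : Mat) j k := by
    by_contra! h
    exact hi (Subtype.ext (Matrix.ext h))
  refine ⟨_, ⟨SmoothFn.restrict ⟨fun x => x i j k, ?_⟩, ⟨_, rfl⟩, rfl⟩, hjk⟩
  exact (LinearMap.toContinuousLinearMap (Matrix.entryLinearMap ℝ ℂ j k)).contDiff.comp
    (contDiff_apply ℝ Mat i)

section Geometry

variable {M : Type*} [TopologicalSpace M] [ChartedSpace (EuclideanSpace ℝ (Fin 3)) M]

/-! ### Coefficients of the fluxes -/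

open Classical in
/-- The function `κ(e_p) f_I(p)` for the germ of a curve along a filter at a point `p`. -/
def coeffGerm (S : Surface M) (f : CovectorField S) (p : M) (e : ℝ → M) (l : Filter ℝ) (I : Fin 3) :
    ℝ :=
  if h : p ∈ S.carrier then kappa S p e l * f.toFun ⟨p, h⟩ I else 0

lemma coeffGerm_add (S : Surface M) (f f' : CovectorField S) (p : M) (e : ℝ → M) (l : Filter ℝ)
    (I : Fin 3) : coeffGerm S (f + f') p e l I = coeffGerm S f p e l I + coeffGerm S f' p e l I := by
  unfold coeffGerm
  split_ifs with h
  · exact mul_add _ _ _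
  · simp

lemma kappa_congr {S T : Surface M} {p : M} {e : ℝ → M} {l : Filter ℝ} (he : Tendsto e l (𝓝 p))
    (h : SameSide (T.side p) (S.side p) p) : kappa T p e l = kappa S p e l := by
  have h1 : ∀ᶠ t in l, SignType.sign (T.side p (e t)) = SignType.sign (S.side p (e t)) :=
    he.eventually h
  have hpos : (∀ᶠ t in l, 0 < T.side p (e t)) ↔ ∀ᶠ t in l, 0 < S.side p (e t) :=
    eventually_congr (h1.mono fun t ht => by
      rw [← sign_eq_one_iff, ht, sign_eq_one_iff])
  have hneg : (∀ᶠ t in l, T.side p (e t) < 0) ↔ ∀ᶠ t in l, S.side p (e t) < 0 :=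
    eventually_congr (h1.mono fun t ht => by
      rw [← sign_eq_neg_one_iff, ht, sign_eq_neg_one_iff])
  classical exact if_congr hpos rfl (if_congr hneg rfl rfl)

/-- Along a nontrivial filter at most one of the two conditions in `kappa` holds, so exchanging them
changes the sign. -/
lemma kappa_neg {S T : Surface M} {p : M} {e : ℝ → M} {l : Filter ℝ} [l.NeBot]
    (he : Tendsto e l (𝓝 p)) (h : SameSide (T.side p) (fun x => -S.side p x) p) :
    kappa T p e l = -kappa S p e l := by
  have h1 : ∀ᶠ t in l, SignType.sign (T.side p (e t)) = SignType.sign (-S.side p (e t)) :=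
    he.eventually h
  have hpos : (∀ᶠ t in l, 0 < T.side p (e t)) ↔ ∀ᶠ t in l, S.side p (e t) < 0 :=
    eventually_congr (h1.mono fun t ht => by
      rw [← sign_eq_one_iff, ht, sign_eq_one_iff, neg_pos])
  have hneg : (∀ᶠ t in l, T.side p (e t) < 0) ↔ ∀ᶠ t in l, 0 < S.side p (e t) :=
    eventually_congr (h1.mono fun t ht => by
      rw [← sign_eq_neg_one_iff, ht, sign_eq_neg_one_iff, neg_neg_iff_pos])
  have hnot : ¬ ((∀ᶠ t in l, S.side p (e t) < 0) ∧ ∀ᶠ t in l, 0 < S.side p (e t)) := fun ⟨h2, h3⟩ => by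
    obtain ⟨t, ht, ht'⟩ := (h2.and h3).exists
    exact lt_asymm ht ht'
  simp only [kappa, hpos, hneg]
  split_ifs <;> simp_all

/-- A point of `S ∪ S'` lies on exactly one of `D`, `D'`, `T`. On `T`, a reversed orientation of
`S'` changes the sign of `κ`, which the sign `ε` in front of `f'` compensates. -/
lemma coeffGerm_surfaces {S S' D D' T : Surface M} {ε : M → ℝ}
    {f : CovectorField S} {f' : CovectorField S'} {g : CovectorField D} {g' : CovectorField D'}
    {h : CovectorField T}
    (hD : IsPiece D S (S.carrier \ S'.carrier)) (hD' : IsPiece D' S' (S'.carrier \ S.carrier))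
    (hT : IsPiece T S (S.carrier ∩ S'.carrier)) (hε : IsRelativeOrientation S S' ε)
    (hg : ∀ p hp hp', g.toFun ⟨p, hp⟩ = f.toFun ⟨p, hp'⟩)
    (hg' : ∀ p hp hp', g'.toFun ⟨p, hp⟩ = f'.toFun ⟨p, hp'⟩)
    (hh : ∀ p hp hp' hp'', h.toFun ⟨p, hp⟩ = f.toFun ⟨p, hp'⟩ + ε p • f'.toFun ⟨p, hp''⟩)
    {p : M} {e : ℝ → M} {l : Filter ℝ} [l.NeBot] (he : Tendsto e l (𝓝 p)) (I : Fin 3) :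
    coeffGerm S f p e l I + coeffGerm S' f' p e l I =
      coeffGerm D g p e l I + coeffGerm D' g' p e l I + coeffGerm T h p e l I := by
  unfold coeffGerm
  by_cases h1 : p ∈ S.carrier <;> by_cases h2 : p ∈ S'.carrier
  · have hD0 : p ∉ D.carrier := by rw [hD.1]; exact fun h => h.2 h2
    have hD0' : p ∉ D'.carrier := by rw [hD'.1]; exact fun h => h.2 h1
    have hT1 : p ∈ T.carrier := by rw [hT.1]; exact ⟨h1, h2⟩
    rw [dif_pos h1, dif_pos h2, dif_neg hD0, dif_neg hD0', dif_pos hT1, hh p hT1 h1 h2,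
      kappa_congr he (hT.2.2 p ⟨h1, h2⟩), Pi.add_apply, Pi.smul_apply, smul_eq_mul]
    rcases hε p ⟨h1, h2⟩ with ⟨h3, h4⟩ | ⟨h3, h4⟩
    · rw [h3, kappa_congr he h4]; ring
    · rw [h3, kappa_neg he h4]; ring
  · have hD1 : p ∈ D.carrier := by rw [hD.1]; exact ⟨h1, h2⟩
    have hD0' : p ∉ D'.carrier := by rw [hD'.1]; exact fun h => h2 h.1
    have hT0 : p ∉ T.carrier := by rw [hT.1]; exact fun h => h2 h.2
    rw [dif_pos h1, dif_neg h2, dif_pos hD1, dif_neg hD0', dif_neg hT0, hg p hD1 h1,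
      kappa_congr he (hD.2.2 p ⟨h1, h2⟩)]
    ring
  · have hD0 : p ∉ D.carrier := by rw [hD.1]; exact fun h => h1 h.1
    have hD1' : p ∈ D'.carrier := by rw [hD'.1]; exact ⟨h2, h1⟩
    have hT0 : p ∉ T.carrier := by rw [hT.1]; exact fun h => h1 h.1
    rw [dif_neg h1, dif_pos h2, dif_neg hD0, dif_pos hD1', dif_neg hT0, hg' p hD1' h2,
      kappa_congr he (hD'.2.2 p ⟨h2, h1⟩)]
    ring
  · have hD0 : p ∉ D.carrier := by rw [hD.1]; exact fun h => h1 h.1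
    have hD0' : p ∉ D'.carrier := by rw [hD'.1]; exact fun h => h2 h.1
    have hT0 : p ∉ T.carrier := by rw [hT.1]; exact fun h => h1 h.1
    rw [dif_neg h1, dif_neg h2, dif_neg hD0, dif_neg hD0', dif_neg hT0]
    ring

lemma Edge.tendsto_start (e : Edge M) : Tendsto e.toFun (𝓝[>] 0) (𝓝 (e.toFun 0)) :=
  (e.continuousAt (by simp)).mono_left nhdsWithin_le_nhds

lemma Edge.tendsto_end (e : Edge M) : Tendsto e.toFun (𝓝[<] 1) (𝓝 (e.toFun 1)) :=
  (e.continuousAt (by simp)).mono_left nhdsWithin_le_nhds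

variable [IsManifold (𝓡 3) ω M]

/-! ### The closure of the smooth cylindrical functions -/

lemma star_mem_cylSmooth {c : Cyl M} (hc : c ∈ CylSmooth M) : star c ∈ CylSmooth M := by
  induction hc using Algebra.adjoin_induction with
  | mem x hx =>
    obtain ⟨γ, G, rfl⟩ := hx
    exact Algebra.subset_adjoin ⟨γ, ⟨fun x => star (G.1 x), Complex.conjCLE.contDiff.comp G.2⟩, rfl⟩
  | algebraMap z =>
    rw [← algebraMap_star_comm]
    exact Subalgebra.algebraMap_mem _ _
  | add x y _ _ hx hy => rw [star_add]; exact add_mem hx hy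
  | mul x y _ _ hx hy => rw [star_mul]; exact mul_mem hy hx

lemma continuous_cyl_of (γ : Graph M) : Continuous (Cyl.of γ) := by
  refine LipschitzWith.continuous (K := 1) (LipschitzWith.of_dist_le_mul fun g g' => ?_)
  rw [NNReal.coe_one, one_mul]
  change dist (cylFun γ g) (cylFun γ g') ≤ dist g g'
  exact (BoundedContinuousFunction.dist_le dist_nonneg).mpr fun A =>
    ContinuousMap.dist_apply_le_dist (f := g) (g := g') fun i => holonomy A (γ.edge i)

lemma cyl_of_mem_closure (γ : Graph M) (g : C(Fin γ.n → SU2, ℂ)) :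
    Cyl.of γ g ∈ (CylSmooth M).topologicalClosure := by
  have hg : g ∈ closure (range (SmoothFn.restrict (n := γ.n))) := by
    have : g ∈ (smoothStarSubalgebra γ.n).topologicalClosure := by
      rw [smoothStarSubalgebra_dense]; trivial
    exact this
  refine map_mem_closure (continuous_cyl_of γ) hg ?_
  rintro _ ⟨G, rfl⟩
  exact Algebra.subset_adjoin ⟨γ, G, rfl⟩

/-- The closure of `Cyl^∞`, as a *-algebra of functions of connections. -/
def cylSmoothClosure (M : Type*) [TopologicalSpace M] [ChartedSpace (EuclideanSpace ℝ (Fin 3)) M]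
    [IsManifold (𝓡 3) ω M] : StarSubalgebra ℂ (BoundedContinuousFunction (Connection M) ℂ) :=
  { (CylSmooth M).topologicalClosure.map (Cyl M).toSubalgebra.val with
    star_mem' := by
      rintro _ ⟨c, hc, rfl⟩
      exact ⟨(star c : Cyl M), map_mem_closure (continuous_star (R := Cyl M)) hc
        fun _ => star_mem_cylSmooth, rfl⟩ }

/-- `Cyl^∞` is dense in `Cyl`. -/
theorem dense_cylSmooth : Dense (CylSmooth M : Set (Cyl M)) := by
  have hle : Cyl M ≤ cylSmoothClosure M := by
    refine StarSubalgebra.topologicalClosure_minimal (StarAlgebra.adjoin_le ?_) ?_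
    · rintro _ ⟨γ, g, rfl⟩
      exact ⟨Cyl.of γ g, cyl_of_mem_closure γ g, rfl⟩
    -- Since `Cyl` is closed, a closed subset of it is closed among all bounded functions.
    · have hcl : IsClosed (Cyl M : Set (BoundedContinuousFunction (Connection M) ℂ)) := inferInstance
      exact hcl.isClosedEmbedding_subtypeVal.isClosedMap _
        (Subalgebra.isClosed_topologicalClosure _)
  intro c
  obtain ⟨c', hc', h⟩ := hle c.2
  rwa [← Subtype.ext h]

/-! ### Linear relations between the fluxes -/

/-- For a fixed graph the fluxes differ only in the coefficients of the same invariant vector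
fields, in which they are linear. -/
lemma fluxRelation_of_coeff (lP : ℝ) {k : ℕ} (a : Fin k → ℂ) (S : Fin k → Surface M)
    (f : ∀ j, CovectorField (S j))
    (hs : ∀ e I, ∑ j, a j * (coeffStart (S j) (f j) e I : ℂ) = 0)
    (he : ∀ e I, ∑ j, a j * (coeffEnd (S j) (f j) e I : ℂ) = 0) : FluxRelation lP a S f := by
  intro γ _ G
  refine Subtype.ext (DFunLike.ext _ _ fun A => ?_)
  let x : Fin γ.n → Mat := fun i => (holonomy A (γ.edge i) : Mat)
  have hval : ((∑ j, a j • Cyl.of γ (fluxOn lP γ (S j) (f j) G).restrict : Cyl M) :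
      BoundedContinuousFunction (Connection M) ℂ) A =
      ∑ j, a j * (fluxOn lP γ (S j) (f j) G).1 x := by
    rw [AddSubmonoidClass.coe_finsetSum, BoundedContinuousFunction.sum_apply]
    rfl
  rw [hval]
  change ∑ j, a j * ((Complex.I * (lP : ℂ) ^ 2 / 2) * ∑ i, ∑ I,
      ((coeffStart (S j) (f j) (γ.edge i) I : ℂ) * leftField i I G.1 x +
        (coeffEnd (S j) (f j) (γ.edge i) I : ℂ) * rightField i I G.1 x)) = 0
  calc _ = (Complex.I * (lP : ℂ) ^ 2 / 2) * ∑ i, ∑ I, ∑ j,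
        (a j * (coeffStart (S j) (f j) (γ.edge i) I : ℂ) * leftField i I G.1 x +
          a j * (coeffEnd (S j) (f j) (γ.edge i) I : ℂ) * rightField i I G.1 x) := by
        simp_rw [Finset.mul_sum]
        rw [Finset.sum_comm]
        refine Finset.sum_congr rfl fun i _ => ?_
        rw [Finset.sum_comm]
        refine Finset.sum_congr rfl fun I _ => Finset.sum_congr rfl fun j _ => ?_
        ring
    _ = 0 := by
        simp_rw [Finset.sum_add_distrib, ← Finset.sum_mul, hs, he]
        simp

section Representation

variable {lP : ℝ} {H : Type*} [NormedAddCommGroup H] [InnerProductSpace ℂ H] [CompleteSpace H]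

/-- A linear relation between the coefficients of fluxes holds between the operators. -/
lemma Representation.sum_flux_eq_zero (π : Representation M lP H) {k : ℕ} (a : Fin k → ℝ)
    (x : Fin k → Σ S : Surface M, CovectorField S)
    (hx : ∀ (p : M) (e : ℝ → M) (l : Filter ℝ), l.NeBot → Tendsto e l (𝓝 p) → ∀ I,
      ∑ j, a j * coeffGerm (x j).1 (x j).2 p e l I = 0)
    (ψ : H) (h : ∀ j, ψ ∈ (π.flux (x j).1 (x j).2).domain) :
    ∑ j, (a j : ℂ) • π.flux (x j).1 (x j).2 ⟨ψ, h j⟩ = 0 := by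
  refine π.linear (fun j => (a j : ℂ)) (fun j => (x j).1) (fun j => (x j).2)
    (fluxRelation_of_coeff lP _ _ _ (fun e I => ?_) fun e I => ?_) ψ h
  · exact_mod_cast hx _ _ _ inferInstance e.tendsto_start I
  · exact_mod_cast hx _ _ _ inferInstance e.tendsto_end I

lemma Representation.flux_add (π : Representation M lP H) (S : Surface M) (f f' : CovectorField S)
    (ψ : H) (h : ψ ∈ (π.flux S (f + f')).domain) (h1 : ψ ∈ (π.flux S f).domain)
    (h2 : ψ ∈ (π.flux S f').domain) :
    π.flux S (f + f') ⟨ψ, h⟩ = π.flux S f ⟨ψ, h1⟩ + π.flux S f' ⟨ψ, h2⟩ := by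
  have key := π.sum_flux_eq_zero ![1, -1, -1] ![⟨S, f + f'⟩, ⟨S, f⟩, ⟨S, f'⟩]
    (fun p e l _ _ I => by
      simp only [Fin.sum_univ_three, Matrix.cons_val, coeffGerm_add]
      ring) ψ (fun j => by fin_cases j <;> assumption)
  simp only [Fin.sum_univ_three, Matrix.cons_val] at key
  rw [← sub_eq_zero, ← key]
  push_cast
  module

lemma Representation.flux_surfaces (π : Representation M lP H) {S S' D D' T : Surface M} {ε : M → ℝ}
    {f : CovectorField S} {f' : CovectorField S'} {g : CovectorField D} {g' : CovectorField D'}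
    {h : CovectorField T}
    (hD : IsPiece D S (S.carrier \ S'.carrier)) (hD' : IsPiece D' S' (S'.carrier \ S.carrier))
    (hT : IsPiece T S (S.carrier ∩ S'.carrier)) (hε : IsRelativeOrientation S S' ε)
    (hg : ∀ p hp hp', g.toFun ⟨p, hp⟩ = f.toFun ⟨p, hp'⟩)
    (hg' : ∀ p hp hp', g'.toFun ⟨p, hp⟩ = f'.toFun ⟨p, hp'⟩)
    (hh : ∀ p hp hp' hp'', h.toFun ⟨p, hp⟩ = f.toFun ⟨p, hp'⟩ + ε p • f'.toFun ⟨p, hp''⟩)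
    (ψ : H) (h1 : ψ ∈ (π.flux S f).domain) (h2 : ψ ∈ (π.flux S' f').domain)
    (h3 : ψ ∈ (π.flux D g).domain) (h4 : ψ ∈ (π.flux D' g').domain)
    (h5 : ψ ∈ (π.flux T h).domain) :
    π.flux S f ⟨ψ, h1⟩ + π.flux S' f' ⟨ψ, h2⟩ =
      π.flux D g ⟨ψ, h3⟩ + π.flux D' g' ⟨ψ, h4⟩ + π.flux T h ⟨ψ, h5⟩ := by
  have key := π.sum_flux_eq_zero ![1, 1, -1, -1, -1] ![⟨S, f⟩, ⟨S', f'⟩, ⟨D, g⟩, ⟨D', g'⟩, ⟨T, h⟩]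
    (fun p e l _ he I => by
      have := coeffGerm_surfaces hD hD' hT hε hg hg' hh he I
      simp only [Fin.sum_univ_five, Matrix.cons_val]
      linear_combination this) ψ (fun j => by fin_cases j <;> assumption)
  simp only [Fin.sum_univ_five, Matrix.cons_val] at key
  rw [← sub_eq_zero, ← key]
  push_cast
  module

end Representation

end Geometry

section Geometry

variable {M : Type*} [TopologicalSpace M] [ChartedSpace (EuclideanSpace ℝ (Fin 3)) M]
  [IsManifold (𝓡 3) ω M]

/-! ### The Hilbert spaces `L²` on the spectrum -/

lemma gelfand_star (c : Cyl M) : gelfand (star c) = star (gelfand c) :=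
  gelfandTransform_map_star c

lemma gelfand_star_apply (c : Cyl M) (x : GenConnection M) :
    gelfand (star c) x = starRingEnd ℂ (gelfand c x) := by
  rw [gelfand_star]; rfl

lemma gelfand_surjective (g : C(GenConnection M, ℂ)) : ∃ c : Cyl M, gelfand c = g :=
  (gelfandTransform_bijective (Cyl M)).2 g

lemma gelfand_injective {c d : Cyl M} (h : gelfand c = gelfand d) : c = d :=
  (gelfandTransform_bijective (Cyl M)).1 h

lemma gelfand_mul_apply (c d : Cyl M) (x : GenConnection M) :
    gelfand (c * d) x = gelfand c x * gelfand d x := by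
  rw [gelfand, map_mul]; rfl

lemma gelfand_add_apply (c d : Cyl M) (x : GenConnection M) :
    gelfand (c + d) x = gelfand c x + gelfand d x := by
  rw [gelfand, map_add]; rfl

lemma gelfand_smul_apply (z : ℂ) (c : Cyl M) (x : GenConnection M) :
    gelfand (z • c) x = z * gelfand c x := by
  rw [gelfand, map_smul]; rfl

variable (μ : FiniteMeasure (GenConnection M))

lemma coeFn_toL2 (c : Cyl M) :
    toL2 μ c =ᵐ[(μ : Measure (GenConnection M))] gelfand c := MemLp.coeFn_toLp _

lemma coeFn_mulL2 (c : Cyl M) (F : L2 μ) :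
    mulL2 μ c F =ᵐ[(μ : Measure (GenConnection M))] fun x => gelfand c x * F x :=
  MemLp.coeFn_toLp _

lemma inner_toL2_left (c : Cyl M) (F : L2 μ) :
    ⟪toL2 μ c, F⟫_ℂ = ∫ x, gelfand (star c) x * F x ∂(μ : Measure (GenConnection M)) := by
  rw [MeasureTheory.L2.inner_def]
  refine integral_congr_ae ?_
  filter_upwards [coeFn_toL2 μ c] with x hx
  rw [hx, gelfand_star_apply, RCLike.inner_apply, mul_comm]

lemma inner_toL2_toL2 (c d : Cyl M) :
    ⟪toL2 μ c, toL2 μ d⟫_ℂ = ∫ x, gelfand (star c * d) x ∂(μ : Measure (GenConnection M)) := by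
  rw [inner_toL2_left]
  refine integral_congr_ae ?_
  filter_upwards [coeFn_toL2 μ d] with x hx
  rw [hx, gelfand_mul_apply]

/-- The map from `Cyl` to `L²`, as a linear map. -/
def toL2Linear : Cyl M →ₗ[ℂ] L2 μ where
  toFun := toL2 μ
  map_add' c d := by
    refine Lp.ext ?_
    filter_upwards [coeFn_toL2 μ c, coeFn_toL2 μ d, coeFn_toL2 μ (c + d),
      Lp.coeFn_add (toL2 μ c) (toL2 μ d)] with x h1 h2 h3 h4
    rw [h4, Pi.add_apply, h1, h2, h3, gelfand, map_add]
    rfl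
  map_smul' z c := by
    refine Lp.ext ?_
    filter_upwards [coeFn_toL2 μ c, coeFn_toL2 μ (z • c), Lp.coeFn_smul z (toL2 μ c)]
      with x h1 h2 h3
    rw [RingHom.id_apply, h3, Pi.smul_apply, h1, h2, gelfand, map_smul]
    rfl

lemma integrable_L2 (F : L2 μ) : Integrable F (μ : Measure (GenConnection M)) :=
  (Lp.memLp F).integrable (by norm_num)

lemma integrable_gelfand_mul (c : Cyl M) (F : L2 μ) :
    Integrable (fun x => gelfand c x * F x) (μ : Measure (GenConnection M)) :=
  (memLp_gelfand_mul μ c (Lp.memLp F)).integrable (by norm_num)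

lemma integrable_gelfand (c : Cyl M) :
    Integrable (gelfand c) (μ : Measure (GenConnection M)) :=
  (integrable_L2 μ (toL2 μ c)).congr (coeFn_toL2 μ c)

/-- `Cyl` is dense in `L²`. -/
theorem denseRange_toL2 : DenseRange (toL2Linear μ) := by
  -- A function orthogonal to `Cyl` integrates to zero against all continuous functions, hence
  -- vanishes almost everywhere.
  have h : (LinearMap.range (toL2Linear μ))ᗮ = ⊥ := by
    rw [Submodule.eq_bot_iff]
    intro F hF
    refine Lp.eq_zero_iff_ae_eq_zero.mpr
      (ae_eq_zero_of_forall_integral_eq_zero rfl (integrable_L2 μ F) fun c => ?_)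
    obtain ⟨d, rfl⟩ := gelfand_surjective c
    have := (Submodule.mem_orthogonal _ F).mp hF _ ⟨star d, rfl⟩
    rw [← star_star d, ← inner_toL2_left]
    exact this
  have h2 := (Submodule.topologicalClosure_eq_top_iff).mpr h
  exact (Submodule.dense_iff_topologicalClosure_eq_top.mpr h2)

/-- Multiplication by an element of `Cyl` as a bounded operator on `L²`. -/
def mulL2CLM (c : Cyl M) : L2 μ →L[ℂ] L2 μ :=
  LinearMap.mkContinuous
    { toFun := mulL2 μ c
      map_add' := fun F G => by
        refine Lp.ext ?_
        filter_upwards [coeFn_mulL2 μ c F, coeFn_mulL2 μ c G, coeFn_mulL2 μ c (F + G),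
          Lp.coeFn_add (mulL2 μ c F) (mulL2 μ c G), Lp.coeFn_add F G] with x h1 h2 h3 h4 h5
        rw [h4, Pi.add_apply, h1, h2, h3, h5, Pi.add_apply, mul_add]
      map_smul' := fun z F => by
        refine Lp.ext ?_
        filter_upwards [coeFn_mulL2 μ c F, coeFn_mulL2 μ c (z • F), Lp.coeFn_smul z (mulL2 μ c F),
          Lp.coeFn_smul z F] with x h1 h2 h3 h4
        rw [RingHom.id_apply, h3, Pi.smul_apply, h1, h2, h4, Pi.smul_apply, smul_eq_mul,
          smul_eq_mul, mul_left_comm] }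
    ‖gelfand c‖ fun F => by
      refine Lp.norm_le_mul_norm_of_ae_le_mul ?_
      filter_upwards [coeFn_mulL2 μ c F] with x hx
      change ‖mulL2 μ c F x‖ ≤ _
      rw [hx, norm_mul]
      exact mul_le_mul_of_nonneg_right ((gelfand c).norm_coe_le_norm x) (norm_nonneg _)

lemma mulL2_toL2 (c d : Cyl M) : mulL2 μ c (toL2 μ d) = toL2 μ (c * d) := by
  refine Lp.ext ?_
  filter_upwards [coeFn_mulL2 μ c (toL2 μ d), coeFn_toL2 μ d, coeFn_toL2 μ (c * d)] with x h1 h2 h3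
  rw [h1, h2, h3, gelfand_mul_apply]

variable {μ}

theorem finiteMeasure_eq {μ ν : FiniteMeasure (GenConnection M)}
    (h : ∀ c : Cyl M, ∫ x, gelfand c x ∂(μ : Measure (GenConnection M)) =
      ∫ x, gelfand c x ∂(ν : Measure (GenConnection M))) : μ = ν := by
  refine finiteMeasure_eq_of_forall_integral_eq rfl fun c => ?_
  obtain ⟨d, rfl⟩ := gelfand_surjective c
  exact h d

section Representation

variable {lP : ℝ} {H : Type*} [NormedAddCommGroup H] [InnerProductSpace ℂ H] [CompleteSpace H]
  (π : Representation M lP H)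

/-! ### Vector states and their measures -/

lemma Representation.inner_cyl_left (c : Cyl M) (φ ψ : H) :
    ⟪π.cyl c φ, ψ⟫_ℂ = ⟪φ, π.cyl (star c) ψ⟫_ℂ := by
  rw [map_star, ContinuousLinearMap.star_eq_adjoint, ContinuousLinearMap.adjoint_inner_right]

lemma Representation.cyl_mul_apply (c d : Cyl M) (ψ : H) :
    π.cyl (c * d) ψ = π.cyl c (π.cyl d ψ) := by
  rw [map_mul]; rfl

lemma Representation.cyl_one_apply (ψ : H) : π.cyl 1 ψ = ψ := by
  rw [map_one]; rfl

lemma Representation.inner_cyl_cyl (c d : Cyl M) (φ ψ : H) :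
    ⟪π.cyl c φ, π.cyl d ψ⟫_ℂ = ⟪φ, π.cyl (star c * d) ψ⟫_ℂ := by
  rw [π.inner_cyl_left, π.cyl_mul_apply]

lemma Representation.continuous_cyl_apply (ψ : H) : Continuous fun c => π.cyl c ψ := by
  have h : Continuous π.cyl := AddMonoidHomClass.continuous_of_bound π.cyl 1 fun c => by
    simpa using NonUnitalStarAlgHom.norm_apply_le π.cyl c
  exact h.clm_apply continuous_const

/-- A continuous real function on the spectrum, as an element of `Cyl`. -/
def ofRealFun (f : C(GenConnection M, ℝ)) : Cyl M :=
  (gelfandStarTransform (Cyl M)).symm ⟨fun x => (f x : ℂ), by fun_prop⟩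

lemma gelfand_ofRealFun (f : C(GenConnection M, ℝ)) (x : GenConnection M) :
    gelfand (ofRealFun f) x = f x := by
  have h : gelfand (ofRealFun f) = ⟨fun x => (f x : ℂ), by fun_prop⟩ :=
    (gelfandStarTransform (Cyl M)).apply_symm_apply _
  rw [h]; rfl

lemma Representation.inner_ofRealFun_real (v : H) (f : C(GenConnection M, ℝ)) :
    ((⟪v, π.cyl (ofRealFun f) v⟫_ℂ).re : ℂ) = ⟪v, π.cyl (ofRealFun f) v⟫_ℂ := by
  have hs : star (ofRealFun f) = ofRealFun f := gelfand_injective <| by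
    ext x
    rw [gelfand_star_apply, gelfand_ofRealFun, Complex.conj_ofReal]
  have : starRingEnd ℂ ⟪v, π.cyl (ofRealFun f) v⟫_ℂ = ⟪v, π.cyl (ofRealFun f) v⟫_ℂ := by
    rw [inner_conj_symm, π.inner_cyl_left, hs]
  exact Complex.conj_eq_iff_re.mp this

/-- The measure of a vector state. -/
theorem Representation.exists_measure (v : H) : ∃ μ : FiniteMeasure (GenConnection M),
    ∀ c, ∫ x, gelfand c x ∂(μ : Measure (GenConnection M)) = ⟪v, π.cyl c v⟫_ℂ := by
  let Λ : C(GenConnection M, ℝ) →ₗ[ℝ] ℝ :=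
    { toFun := fun f => (⟪v, π.cyl (ofRealFun f) v⟫_ℂ).re
      map_add' := fun f g => by
        have : ofRealFun (f + g) = ofRealFun f + ofRealFun g := gelfand_injective <| by
          ext x
          rw [gelfand_add_apply, gelfand_ofRealFun, gelfand_ofRealFun, gelfand_ofRealFun]
          simp
        rw [this, map_add, _root_.add_apply, inner_add_right, Complex.add_re]
      map_smul' := fun r f => by
        have : ofRealFun (r • f) = (r : ℂ) • ofRealFun f := gelfand_injective <| by
          ext x
          rw [gelfand_smul_apply, gelfand_ofRealFun, gelfand_ofRealFun]
          simp
        rw [this, map_smul, _root_.smul_apply, inner_smul_right, Complex.re_ofReal_mul]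
        rfl }
  obtain ⟨μ, hμ⟩ := exists_baire_measure (X := GenConnection M) rfl Λ fun f hf => by
    -- Positivity: with `g = √f` the functional takes the value `‖π(g) v‖²` at `f`.
    let g : C(GenConnection M, ℝ) := ⟨fun x => √(f x), by fun_prop⟩
    have : ofRealFun f = star (ofRealFun g) * ofRealFun g := gelfand_injective <| by
      ext x
      rw [gelfand_mul_apply, gelfand_star_apply, gelfand_ofRealFun, gelfand_ofRealFun,
        Complex.conj_ofReal, ← Complex.ofReal_mul]
      exact congrArg _ (Real.mul_self_sqrt (hf x)).symm
    change 0 ≤ (⟪v, π.cyl (ofRealFun f) v⟫_ℂ).re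
    rw [this, ← π.inner_cyl_cyl]
    exact inner_self_nonneg (𝕜 := ℂ)
  have hreal : ∀ f : C(GenConnection M, ℝ),
      ∫ x, gelfand (ofRealFun f) x ∂(μ : Measure (GenConnection M)) =
        ⟪v, π.cyl (ofRealFun f) v⟫_ℂ := fun f => by
    rw [← π.inner_ofRealFun_real]
    simp_rw [gelfand_ofRealFun]
    rw [integral_complex_ofReal, hμ f]
    rfl
  refine ⟨μ, fun c => ?_⟩
  let a : Cyl M := ofRealFun ⟨fun x => (gelfand c x).re, by fun_prop⟩
  let b : Cyl M := ofRealFun ⟨fun x => (gelfand c x).im, by fun_prop⟩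
  have hc : c = a + Complex.I • b := gelfand_injective <| by
    ext x
    rw [gelfand_add_apply, gelfand_smul_apply, gelfand_ofRealFun, gelfand_ofRealFun, mul_comm]
    exact (Complex.re_add_im _).symm
  have hint : ∫ x, gelfand c x ∂(μ : Measure (GenConnection M)) =
      ∫ x, gelfand a x ∂(μ : Measure (GenConnection M)) +
        Complex.I * ∫ x, gelfand b x ∂(μ : Measure (GenConnection M)) := by
    rw [← integral_const_mul, ← integral_add (integrable_gelfand μ a)
      ((integrable_gelfand μ b).const_mul _)]
    refine integral_congr_ae (Eventually.of_forall fun x => ?_)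
    change gelfand c x = gelfand a x + Complex.I * gelfand b x
    rw [← gelfand_smul_apply, ← gelfand_add_apply, ← hc]
  have hπ : π.cyl c = π.cyl (a + Complex.I • b) := congrArg _ hc
  rw [hint, hreal, hreal, hπ, map_add, map_smul, _root_.add_apply,
    _root_.smul_apply, inner_add_right, inner_smul_right]

end Representation

end Geometry

/-! ### Coordinates in a Hilbert sum -/

section HilbertSum

variable {N E : Type*} {G : N → Type*} [NormedAddCommGroup E] [InnerProductSpace ℂ E]
  [CompleteSpace E] [∀ i, NormedAddCommGroup (G i)] [∀ i, InnerProductSpace ℂ (G i)]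
  [∀ i, CompleteSpace (G i)] {V : ∀ i, G i →ₗᵢ[ℂ] E}

lemma adjoint_apply_self (i : N) (x : G i) :
    ContinuousLinearMap.adjoint (V i).toContinuousLinearMap (V i x) = x := by
  refine ext_inner_left ℂ fun y => ?_
  rw [ContinuousLinearMap.adjoint_inner_right]
  exact (V i).inner_map_map y x

lemma adjoint_apply_of_ne (hV : OrthogonalFamily ℂ G V) {i j : N} (hij : i ≠ j) (x : G j) :
    ContinuousLinearMap.adjoint (V i).toContinuousLinearMap (V j x) = 0 := by
  refine ext_inner_left ℂ fun y => ?_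
  rw [ContinuousLinearMap.adjoint_inner_right, inner_zero_right]
  exact hV hij y x

/-- The adjoint of `V i` applied to the orthogonal expansion of `φ` leaves only the `i`-th term. -/
lemma linearIsometryEquiv_apply (hV : IsHilbertSum ℂ G V) (φ : E) (i : N) :
    hV.linearIsometryEquiv φ i = ContinuousLinearMap.adjoint (V i).toContinuousLinearMap φ := by
  have h := hV.hasSum_linearIsometryEquiv_symm (hV.linearIsometryEquiv φ)
  rw [LinearIsometryEquiv.symm_apply_apply] at h
  have h1 := (ContinuousLinearMap.adjoint (V i).toContinuousLinearMap).hasSum h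
  have h2 := hasSum_single (f := fun j => ContinuousLinearMap.adjoint (V i).toContinuousLinearMap
    (V j (hV.linearIsometryEquiv φ j))) i fun j hj =>
      adjoint_apply_of_ne hV.OrthogonalFamily hj.symm _
  rw [adjoint_apply_self] at h2
  exact h2.unique h1

lemma hasSum_adjoint (hV : IsHilbertSum ℂ G V) (φ : E) :
    HasSum (fun i => V i (ContinuousLinearMap.adjoint (V i).toContinuousLinearMap φ)) φ := by
  have h := hV.hasSum_linearIsometryEquiv_symm (hV.linearIsometryEquiv φ)
  rw [LinearIsometryEquiv.symm_apply_apply] at h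
  simpa only [linearIsometryEquiv_apply] using h

lemma memℓp_adjoint (hV : IsHilbertSum ℂ G V) (φ : E) :
    Memℓp (fun i => ContinuousLinearMap.adjoint (V i).toContinuousLinearMap φ) 2 := by
  have h := lp.memℓp (hV.linearIsometryEquiv φ)
  convert h using 1
  funext i
  exact (linearIsometryEquiv_apply hV φ i).symm

end HilbertSum

section Geometry

variable {M : Type*} [TopologicalSpace M] [ChartedSpace (EuclideanSpace ℝ (Fin 3)) M]
  [IsManifold (𝓡 3) ω M]

section Representation

variable {lP : ℝ} {H : Type*} [NormedAddCommGroup H] [InnerProductSpace ℂ H] [CompleteSpace H]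
  (π : Representation M lP H)

/-! ### Cyclic decompositions -/

lemma Representation.cyl_mem_cyclicSubspace (v : H) (c : Cyl M) :
    π.cyl c v ∈ π.cyclicSubspace v :=
  Submodule.le_topologicalClosure _ (Submodule.subset_span ⟨c, rfl⟩)

lemma Representation.cyclicSubspace_le {v : H} {K : Submodule ℂ H} (hK : IsClosed (K : Set H))
    (h : ∀ c, π.cyl c v ∈ K) : π.cyclicSubspace v ≤ K :=
  Submodule.topologicalClosure_minimal _ (Submodule.span_le.mpr (by rintro _ ⟨c, rfl⟩; exact h c)) hK

lemma Representation.isClosed_cyclicSubspace (v : H) :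
    IsClosed (π.cyclicSubspace v : Set H) := Submodule.isClosed_topologicalClosure _

/-- Since `⟨π(c) v, π(d) w⟩ = ⟨v, π(c* d) w⟩`, it suffices to test against `v` itself. This
condition on pairs is the one to which Zorn's lemma is applied. -/
lemma Representation.cyclicSubspace_isOrtho {v w : H} (h : ∀ c, ⟪v, π.cyl c w⟫_ℂ = 0) :
    π.cyclicSubspace v ⟂ π.cyclicSubspace w := by
  refine π.cyclicSubspace_le (Submodule.isClosed_orthogonal _) fun c => ?_
  have h2 : π.cyclicSubspace w ≤ (Submodule.span ℂ {π.cyl c v})ᗮ := by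
    refine π.cyclicSubspace_le (Submodule.isClosed_orthogonal _) fun d => ?_
    rw [Submodule.mem_orthogonal_singleton_iff_inner_right, π.inner_cyl_cyl, h]
  refine (Submodule.mem_orthogonal _ _).mpr fun x hx => ?_
  exact inner_eq_zero_symm.mp (Submodule.mem_orthogonal_singleton_iff_inner_right.mp (h2 hx))

/-- Every representation is a Hilbert sum of cyclic representations. -/
theorem Representation.exists_isCyclicDecomposition :
    ∃ s : Set H, π.IsCyclicDecomposition (fun v : s => (v : H)) := by
  obtain ⟨s, hs⟩ := zorn_subset
    {s : Set H | s.Pairwise fun v w => ∀ c, ⟪v, π.cyl c w⟫_ℂ = 0} fun C hC hchain =>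
      ⟨⋃₀ C, (pairwise_sUnion hchain.directedOn).mpr hC, fun t ht => subset_sUnion_of_mem ht⟩
  refine ⟨s, ?_⟩
  have hcomplete : ∀ v : s, CompleteSpace (π.cyclicSubspace (v : H)) := fun v =>
    (π.isClosed_cyclicSubspace v).completeSpace_coe
  refine IsHilbertSum.mkInternal _ ?_ ?_
  · refine OrthogonalFamily.of_pairwise fun v w hvw => ?_
    exact π.cyclicSubspace_isOrtho (hs.prop v.2 w.2 fun h => hvw (Subtype.ext h))
  · rw [top_le_iff, Submodule.topologicalClosure_eq_top_iff, Submodule.eq_bot_iff]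
    intro x hx
    have hxv : ∀ v ∈ s, ∀ c, ⟪π.cyl c v, x⟫_ℂ = 0 := fun v hv c =>
      (Submodule.mem_orthogonal _ _).mp hx _
        (Submodule.mem_iSup_of_mem ⟨v, hv⟩ (π.cyl_mem_cyclicSubspace v c))
    -- A vector `x` orthogonal to all the subspaces may be added to `s`; by maximality it already
    -- belongs to `s`, so it is orthogonal to itself.
    have hins : insert x s ∈ {s : Set H | s.Pairwise fun v w => ∀ c, ⟪v, π.cyl c w⟫_ℂ = 0} := by
      refine hs.prop.insert fun v hv _ => ⟨fun c => ?_, fun c => ?_⟩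
      · exact inner_eq_zero_symm.mp (hxv v hv c)
      · rw [← star_star c, ← π.inner_cyl_left]
        exact hxv v hv _
    have hxs : x ∈ s := hs.le_of_ge hins (subset_insert x s) (mem_insert x s)
    have := hxv x hxs 1
    rwa [π.cyl_one_apply, inner_self_eq_zero] at this

/-! ### The isometries of the cyclic subspaces with `L²` -/

section Isometry

variable {π} {μ : FiniteMeasure (GenConnection M)} {v : H}

/-- `μ` is the measure of the vector state given by `v`. -/
def Representation.IsStateMeasure (π : Representation M lP H) (v : H)
    (μ : FiniteMeasure (GenConnection M)) : Prop :=
  ∀ c, ∫ x, gelfand c x ∂(μ : Measure (GenConnection M)) = ⟪v, π.cyl c v⟫_ℂ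

lemma Representation.IsStateMeasure.norm_eq (h : π.IsStateMeasure v μ) (c : Cyl M) :
    ‖π.cyl c v‖ = ‖toL2 μ c‖ := by
  have h1 : ⟪π.cyl c v, π.cyl c v⟫_ℂ = ⟪toL2 μ c, toL2 μ c⟫_ℂ := by
    rw [π.inner_cyl_cyl, inner_toL2_toL2, h]
  rw [inner_self_eq_norm_sq_to_K, inner_self_eq_norm_sq_to_K] at h1
  have h2 : ‖π.cyl c v‖ ^ 2 = ‖toL2 μ c‖ ^ 2 := by exact_mod_cast h1
  exact (pow_left_inj₀ (norm_nonneg _) (norm_nonneg _) two_ne_zero).mp h2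

/-- The vectors `π(c) v` as a linear function of `c`. -/
def Representation.orbit (π : Representation M lP H) (v : H) : Cyl M →ₗ[ℂ] H where
  toFun c := π.cyl c v
  map_add' c d := by rw [map_add]; rfl
  map_smul' z c := by rw [map_smul]; rfl

/-- The map `Cyl → L²` may have a kernel, but equality of norms makes `c ↦ π(c) v` factor through
its dense image and extend isometrically. -/
theorem Representation.IsStateMeasure.exists_isometry (h : π.IsStateMeasure v μ) :
    ∃ I : L2 μ →ₗᵢ[ℂ] H, ∀ c, I (toL2 μ c) = π.cyl c v := by
  have hI : ∀ c, (π.orbit v).extendOfNorm (toL2Linear μ) (toL2Linear μ c) = π.cyl c v := fun c =>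
    LinearMap.extendOfNorm_eq (denseRange_toL2 μ)
      ⟨1, fun c => by rw [one_mul]; exact (h.norm_eq c).le⟩ c
  refine ⟨⟨((π.orbit v).extendOfNorm (toL2Linear μ)).toLinearMap, fun F => ?_⟩, hI⟩
  refine (denseRange_toL2 μ).induction_on (p := fun F : L2 μ =>
    ‖(π.orbit v).extendOfNorm (toL2Linear μ) F‖ = ‖F‖) F ?_ fun c => ?_
  · exact isClosed_eq (by fun_prop) continuous_norm
  · rw [hI]
    exact h.norm_eq c

variable {I : L2 μ →ₗᵢ[ℂ] H}

lemma isometry_unique {I' : L2 μ →ₗᵢ[ℂ] H} (hI : ∀ c, I (toL2 μ c) = π.cyl c v)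
    (hI' : ∀ c, I' (toL2 μ c) = π.cyl c v) : I' = I := by
  refine LinearIsometry.ext fun F => ?_
  refine congrFun ((denseRange_toL2 μ).equalizer I'.continuous I.continuous (funext fun c => ?_)) F
  exact (hI' c).trans (hI c).symm

lemma cyl_isometry (hI : ∀ c, I (toL2 μ c) = π.cyl c v) (c : Cyl M) (F : L2 μ) :
    π.cyl c (I F) = I (mulL2 μ c F) := by
  have h1 : Continuous fun F => π.cyl c (I F) := (π.cyl c).continuous.comp I.continuous
  have h2 : Continuous fun F => I (mulL2 μ c F) :=
    I.continuous.comp (mulL2CLM μ c).continuous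
  refine congrFun ((denseRange_toL2 μ).equalizer h1 h2 (funext fun d => ?_)) F
  change π.cyl c (I (toL2 μ d)) = I (mulL2 μ c (toL2 μ d))
  rw [hI, mulL2_toL2, hI, π.cyl_mul_apply]

lemma range_isometry (hI : ∀ c, I (toL2 μ c) = π.cyl c v) :
    LinearMap.range I.toLinearMap = π.cyclicSubspace v := by
  apply le_antisymm
  · rintro _ ⟨F, rfl⟩
    refine (denseRange_toL2 μ).induction_on (p := fun F : L2 μ => I F ∈ π.cyclicSubspace v) F ?_
      fun c => ?_
    · exact (π.isClosed_cyclicSubspace v).preimage I.continuous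
    · change I (toL2 μ c) ∈ _
      rw [hI]
      exact π.cyl_mem_cyclicSubspace v c
  · refine π.cyclicSubspace_le ?_ fun c => ⟨toL2 μ c, hI c⟩
    exact I.isometry.isClosedEmbedding.isClosed_range

end Isometry

variable {π}

/-- The ranges of the `I ν` are the given cyclic subspaces, so orthogonality and density carry over.
-/
lemma Representation.IsCyclicDecomposition.isHilbertSum {N : Type*} {Ω : N → H}
    (hΩ : π.IsCyclicDecomposition Ω) {μ : N → FiniteMeasure (GenConnection M)}
    {I : ∀ ν, L2 (μ ν) →ₗᵢ[ℂ] H} (hI : ∀ ν c, I ν (toL2 (μ ν) c) = π.cyl c (Ω ν)) :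
    IsHilbertSum ℂ (fun ν => L2 (μ ν)) I := by
  have hcomplete : ∀ ν, CompleteSpace (π.cyclicSubspace (Ω ν)) := fun ν =>
    (π.isClosed_cyclicSubspace _).completeSpace_coe
  have hmem : ∀ ν F, I ν F ∈ π.cyclicSubspace (Ω ν) := fun ν F => by
    rw [← range_isometry (hI ν)]
    exact ⟨F, rfl⟩
  refine IsHilbertSum.mk (fun ν ν' hne F G => ?_) ?_
  · exact hΩ.OrthogonalFamily hne ⟨_, hmem ν F⟩ ⟨_, hmem ν' G⟩
  · simp_rw [fun ν => range_isometry (hI ν)]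
    have h1 := hΩ.OrthogonalFamily.range_linearIsometry
    have h2 : LinearMap.range hΩ.OrthogonalFamily.linearIsometry.toLinearMap = ⊤ :=
      LinearMap.range_eq_top.mpr hΩ.surjective_isometry
    rw [h2] at h1
    simpa [Submodule.subtypeₗᵢ_toLinearMap, Submodule.range_subtype] using h1.le

end Representation

end Geometry

section Geometry

variable {M : Type*} [TopologicalSpace M] [ChartedSpace (EuclideanSpace ℝ (Fin 3)) M]
  [IsManifold (𝓡 3) ω M]

section Representation

variable {lP : ℝ} {H : Type*} [NormedAddCommGroup H] [InnerProductSpace ℂ H] [CompleteSpace H]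
  {π : Representation M lP H} {N : Type*} {Ω : N → H}

/-! ### The action of the fluxes -/

lemma Representation.DomainAssumption.cyl_mem (hdom : π.DomainAssumption Ω) (S : Surface M)
    (f : CovectorField S) (ν : N) {c : Cyl M} (hc : c ∈ CylSmooth M) :
    π.cyl c (Ω ν) ∈ (π.flux S f).domain :=
  hdom S f (Submodule.subset_span (mem_iUnion.mpr ⟨ν, c, hc, rfl⟩))

lemma Representation.DomainAssumption.mem (hdom : π.DomainAssumption Ω) (S : Surface M)
    (f : CovectorField S) (ν : N) : Ω ν ∈ (π.flux S f).domain := by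
  have := hdom.cyl_mem S f ν (one_mem (CylSmooth M))
  rwa [π.cyl_one_apply] at this

lemma Representation.flux_cyl (π : Representation M lP H) {S : Surface M} {f : CovectorField S}
    {c d : Cyl M} (hcd : IsFlux lP S f c d) {ψ : H} (hψ : ψ ∈ (π.flux S f).domain)
    (hcψ : π.cyl c ψ ∈ (π.flux S f).domain) :
    π.flux S f ⟨π.cyl c ψ, hcψ⟩ = π.cyl c (π.flux S f ⟨ψ, hψ⟩) + π.cyl d ψ := by
  rw [← π.commutator S f c d hcd ψ hψ hcψ]
  abel

variable {μ : N → FiniteMeasure (GenConnection M)} {I : ∀ ν, L2 (μ ν) →ₗᵢ[ℂ] H}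

/-- The functions `F^{ιν}_{S,f}`, the components of the vectors `π(X_{S,f}) Ω_ν`. -/
def fluxFunctions (hdom : π.DomainAssumption Ω) (I : ∀ ν, L2 (μ ν) →ₗᵢ[ℂ] H) : FluxFunctions μ :=
  fun S f ι ν => ContinuousLinearMap.adjoint (I ι).toContinuousLinearMap
    (π.flux S f ⟨Ω ν, hdom.mem S f ν⟩)

lemma inner_cyl_eq_integral (hI : ∀ ν c, I ν (toL2 (μ ν) c) = π.cyl c (Ω ν)) (c : Cyl M) (ι : N)
    (φ : H) : ⟪π.cyl c (Ω ι), φ⟫_ℂ =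
      ∫ x, gelfand (star c) x * (ContinuousLinearMap.adjoint (I ι).toContinuousLinearMap φ :
        L2 (μ ι)) x ∂(μ ι : Measure (GenConnection M)) := by
  rw [← inner_toL2_left, ContinuousLinearMap.adjoint_inner_right]
  exact congrArg (fun x => ⟪x, φ⟫_ℂ) (hI ι c).symm

/-- After the commutator term is removed, `π(c) π(X) Ω_ν` remains. The bounded operator `π(c)` acts
term by term on the expansion of `π(X) Ω_ν`, as multiplication by `c` in each component. -/
lemma hasSum_flux (hdom : π.DomainAssumption Ω) (hs : IsHilbertSum ℂ (fun ν => L2 (μ ν)) I)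
    (hI : ∀ ν c, I ν (toL2 (μ ν) c) = π.cyl c (Ω ν)) {S : Surface M} {f : CovectorField S} (ν : N)
    {c d : Cyl M} (hcd : IsFlux lP S f c d) (h : π.cyl c (Ω ν) ∈ (π.flux S f).domain) :
    HasSum (fun ι => I ι (mulL2 (μ ι) c (fluxFunctions hdom I S f ι ν)))
      (π.flux S f ⟨π.cyl c (Ω ν), h⟩ - I ν (toL2 (μ ν) d)) := by
  rw [hI, π.flux_cyl hcd (hdom.mem S f ν) h, add_sub_cancel_right]
  have := (π.cyl c).hasSum (hasSum_adjoint hs (π.flux S f ⟨Ω ν, hdom.mem S f ν⟩))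
  simpa only [fun ι F => cyl_isometry (hI ι) c F, fluxFunctions] using this

lemma condDom_fluxFunctions (hdom : π.DomainAssumption Ω)
    (hs : IsHilbertSum ℂ (fun ν => L2 (μ ν)) I) : CondDom (fluxFunctions hdom I) :=
  fun _ _ _ => memℓp_adjoint hs _

lemma condAdd_fluxFunctions (hdom : π.DomainAssumption Ω) : CondAdd (fluxFunctions hdom I) := by
  intro S f f'' ι ν
  simp only [fluxFunctions]
  rw [π.flux_add S f f'' _ _ (hdom.mem S f ν) (hdom.mem S f'' ν), map_add]

lemma condSurfaces_fluxFunctions (hdom : π.DomainAssumption Ω) :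
    CondSurfaces (fluxFunctions hdom I) := by
  intro S S' D D' T ε f f' g g' h hD hD' hT hε hg hg' hh ι ν
  simp only [fluxFunctions]
  rw [← map_add, π.flux_surfaces hD hD' hT hε hg hg' hh _ _ _ (hdom.mem D g ν) (hdom.mem D' g' ν)
    (hdom.mem T h ν), map_add, map_add]

/-- Symmetry between `π(c) Ω_ι` and `π(c') Ω_ι` is expanded by the Leibniz rule. The terms without
derivations are integrals of `F` and `conj F` against `conj c · c'`, and `F - conj F = 2i Im F`. -/
lemma condDiv_fluxFunctions (hdom : π.DomainAssumption Ω)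
    (hI : ∀ ν c, I ν (toL2 (μ ν) c) = π.cyl c (Ω ν)) : CondDiv lP (fluxFunctions hdom I) := by
  intro S f ι c d c' d' hcd hcd'
  have hc := hdom.cyl_mem S f ι hcd.mem_cylSmooth
  have hc' := hdom.cyl_mem S f ι hcd'.mem_cylSmooth
  have hsym := π.symmetric_flux S f ⟨_, hc⟩ ⟨_, hc'⟩
  set φ := π.flux S f ⟨Ω ι, hdom.mem S f ι⟩ with hφ
  let F : L2 (μ ι) := fluxFunctions hdom I S f ι ι
  let m : Measure (GenConnection M) := (μ ι : Measure (GenConnection M))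
  rw [π.flux_cyl hcd (hdom.mem S f ι) hc, π.flux_cyl hcd' (hdom.mem S f ι) hc', inner_add_left,
    inner_add_right, ← hφ] at hsym
  have hinner : ∀ a b : Cyl M, ⟪toL2 (μ ι) a, toL2 (μ ι) b⟫_ℂ = ⟪π.cyl a (Ω ι), π.cyl b (Ω ι)⟫_ℂ :=
    fun a b => by rw [← hI, ← hI, (I ι).inner_map_map]
  have h1 : ⟪π.cyl c (Ω ι), π.cyl c' φ⟫_ℂ = ∫ x, gelfand (star c * c') x * F x ∂m := by
    rw [← star_star c', ← π.inner_cyl_left, ← π.cyl_mul_apply, inner_cyl_eq_integral hI, star_mul,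
      star_star]
    rfl
  have h2 : ⟪π.cyl c φ, π.cyl c' (Ω ι)⟫_ℂ =
      ∫ x, starRingEnd ℂ (gelfand (star c' * c) x * F x) ∂m := by
    rw [integral_conj, ← inner_conj_symm, ← star_star c, ← π.inner_cyl_left, ← π.cyl_mul_apply,
      inner_cyl_eq_integral hI, star_mul, star_star]
    rfl
  rw [h1, h2] at hsym
  rw [hinner, hinner, ← integral_const_mul]
  have hint1 : Integrable (fun x => gelfand (star c * c') x * F x) m :=
    integrable_gelfand_mul (μ ι) _ F
  have hint2 : Integrable (fun x => starRingEnd ℂ (gelfand (star c' * c) x * F x)) m :=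
    Complex.conjCLE.toContinuousLinearMap.integrable_comp (integrable_gelfand_mul (μ ι) _ F)
  calc _ = ∫ x, gelfand (star c * c') x * F x ∂m -
        ∫ x, starRingEnd ℂ (gelfand (star c' * c) x * F x) ∂m := by
        linear_combination hsym
    _ = _ := by
        rw [← integral_sub hint1 hint2]
        refine integral_congr_ae (Eventually.of_forall fun x => ?_)
        change gelfand (star c * c') x * F x - starRingEnd ℂ (gelfand (star c' * c) x * F x) =
          2 * Complex.I * (starRingEnd ℂ (gelfand c x) * ((F x).im * gelfand c' x))
        rw [gelfand_mul_apply, gelfand_mul_apply, gelfand_star_apply, gelfand_star_apply, map_mul,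
          map_mul, Complex.conj_conj]
        have := Complex.sub_conj (F x)
        push_cast at this
        linear_combination (starRingEnd ℂ (gelfand c x) * gelfand c' x) * this

lemma condSymm_fluxFunctions (hdom : π.DomainAssumption Ω)
    (hs : IsHilbertSum ℂ (fun ν => L2 (μ ν)) I)
    (hI : ∀ ν c, I ν (toL2 (μ ν) c) = π.cyl c (Ω ν)) : CondSymm (fluxFunctions hdom I) := by
  intro S f ι ν hne
  set φ := π.flux S f ⟨Ω ι, hdom.mem S f ι⟩ with hφ
  set χ := π.flux S f ⟨Ω ν, hdom.mem S f ν⟩ with hχ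
  have hsmooth : ∀ c ∈ CylSmooth M, ⟪φ, π.cyl c (Ω ν)⟫_ℂ = ⟪Ω ι, π.cyl c χ⟫_ℂ := by
    intro c hc
    obtain ⟨d, hd⟩ := exists_isFlux lP S f hc
    have h := π.symmetric_flux S f ⟨_, hdom.mem S f ι⟩ ⟨_, hdom.cyl_mem S f ν hc⟩
    -- The derivation term stays in the component `ν` and is orthogonal to `Ω_ι`.
    have h0 : ⟪Ω ι, π.cyl d (Ω ν)⟫_ℂ = 0 := by
      have := hs.OrthogonalFamily hne (toL2 (μ ι) 1) (toL2 (μ ν) d)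
      rwa [hI, hI, π.cyl_one_apply] at this
    rw [π.flux_cyl hd (hdom.mem S f ν), inner_add_right, h0, add_zero] at h
    exact h
  -- No derivative of `c` is left and both sides are continuous in `c`, so the identity extends to
  -- `Cyl`; it can then be tested on all continuous functions.
  have hall : ∀ c : Cyl M, ⟪φ, π.cyl c (Ω ν)⟫_ℂ = ⟪Ω ι, π.cyl c χ⟫_ℂ := by
    have h1 : Continuous fun c => ⟪φ, π.cyl c (Ω ν)⟫_ℂ :=
      continuous_const.inner (π.continuous_cyl_apply _)
    have h2 : Continuous fun c => ⟪Ω ι, π.cyl c χ⟫_ℂ :=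
      continuous_const.inner (π.continuous_cyl_apply _)
    exact fun c => congrFun (h1.ext_on dense_cylSmooth h2 hsmooth) c
  let F : L2 (μ ν) := fluxFunctions hdom I S f ν ι
  let G : L2 (μ ι) := fluxFunctions hdom I S f ι ν
  have hF : Integrable F (μ ν : Measure (GenConnection M)) := integrable_L2 (μ ν) F
  have hG : Integrable (fun x => starRingEnd ℂ (G x)) (μ ι : Measure (GenConnection M)) :=
    Complex.conjCLE.toContinuousLinearMap.integrable_comp (integrable_L2 (μ ι) G)
  have hint : ∀ c : C(GenConnection M, ℂ), ∫ x, c x * F x ∂(μ ν : Measure (GenConnection M)) =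
      ∫ x, c x * starRingEnd ℂ (G x) ∂(μ ι : Measure (GenConnection M)) := by
    intro g
    obtain ⟨c, rfl⟩ := gelfand_surjective g
    have h1 : ⟪π.cyl (star c) (Ω ν), φ⟫_ℂ =
        ∫ x, gelfand c x * F x ∂(μ ν : Measure (GenConnection M)) := by
      rw [inner_cyl_eq_integral hI, star_star]
      rfl
    have h2 : ⟪π.cyl c (Ω ι), χ⟫_ℂ =
        ∫ x, starRingEnd ℂ (gelfand c x * starRingEnd ℂ (G x))
          ∂(μ ι : Measure (GenConnection M)) := by
      rw [inner_cyl_eq_integral hI]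
      simp only [map_mul, Complex.conj_conj, gelfand_star_apply]
      rfl
    rw [integral_conj] at h2
    rw [← h1, ← inner_conj_symm, hall, ← π.inner_cyl_left, h2, Complex.conj_conj]
  refine VectorMeasure.ext fun s hs => ?_
  rw [withDensityᵥ_apply hF hs, withDensityᵥ_apply hG hs]
  exact setIntegral_eq_of_forall_integral_eq rfl hF hG hint hs

end Representation

end Geometry

end LQG

end

/-! ### The theorem -/

theorem proposition1
    {M : Type v} [TopologicalSpace M] [T2Space M] [SecondCountableTopology M]
    [ChartedSpace (EuclideanSpace ℝ (Fin 3)) M] [IsManifold (𝓡 3) ω M]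
    (lP : ℝ) (hlP : 0 < lP)
    {H : Type u} [NormedAddCommGroup H] [InnerProductSpace ℂ H] [CompleteSpace H]
    (π : LQG.Representation M lP H) :
    (∃ (N : Type u) (Ω : N → H), π.IsCyclicDecomposition Ω) ∧
    ∀ {N : Type w} (Ω : N → H), π.IsCyclicDecomposition Ω → π.DomainAssumption Ω →
      ∃! μ : N → FiniteMeasure (LQG.GenConnection M),
        (∀ ν c, ∫ x, LQG.gelfand c x ∂(μ ν : Measure (LQG.GenConnection M)) =
          ⟪Ω ν, π.cyl c (Ω ν)⟫_ℂ) ∧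
        ∃! I : ∀ ν, LQG.L2 (μ ν) →ₗᵢ[ℂ] H,
          (IsHilbertSum ℂ (fun ν => LQG.L2 (μ ν)) I ∧
            (∀ ν c, I ν (LQG.toL2 (μ ν) c) = π.cyl c (Ω ν)) ∧
            (∀ ν c ψ, π.cyl c (I ν ψ) = I ν (LQG.mulL2 (μ ν) c ψ))) ∧
          ∃! F : LQG.FluxFunctions μ,
            (∀ S f ι ν (h : Ω ν ∈ (π.flux S f).domain),
              F S f ι ν = ContinuousLinearMap.adjoint (I ι).toContinuousLinearMap
                (π.flux S f ⟨Ω ν, h⟩)) ∧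
            (∀ S f ν, ∀ c ∈ LQG.CylSmooth M, (∃ d, LQG.IsFlux lP S f c d) ∧
              ∀ d, LQG.IsFlux lP S f c d → ∀ h : π.cyl c (Ω ν) ∈ (π.flux S f).domain,
                HasSum (fun ι => I ι (LQG.mulL2 (μ ι) c (F S f ι ν)))
                  (π.flux S f ⟨π.cyl c (Ω ν), h⟩ - I ν (LQG.toL2 (μ ν) d))) ∧
            LQG.CondDom F ∧ LQG.CondAdd F ∧ LQG.CondSurfaces F ∧
            LQG.CondDiv lP F ∧ LQG.CondSymm F := by
  constructor
  · obtain ⟨s, hs⟩ := π.exists_isCyclicDecomposition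
    exact ⟨s, _, hs⟩
  intro N Ω hΩ hdom
  choose μ hμ using fun ν => π.exists_measure (Ω ν)
  choose I hI using fun ν =>
    LQG.Representation.IsStateMeasure.exists_isometry (π := π) (v := Ω ν) (hμ ν)
  have hsum := hΩ.isHilbertSum hI
  refine ⟨μ, ⟨hμ, I, ⟨⟨hsum, hI, fun ν c ψ => LQG.cyl_isometry (hI ν) c ψ⟩,
    LQG.fluxFunctions hdom I, ⟨fun S f ι ν _ => rfl, fun S f ν c hc =>
      ⟨LQG.exists_isFlux lP S f hc, fun d hd h => LQG.hasSum_flux hdom hsum hI ν hd h⟩,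
      LQG.condDom_fluxFunctions hdom hsum, LQG.condAdd_fluxFunctions hdom,
      LQG.condSurfaces_fluxFunctions hdom, LQG.condDiv_fluxFunctions hdom hI,
      LQG.condSymm_fluxFunctions hdom hsum hI⟩, ?_⟩, ?_⟩, ?_⟩
  -- Uniqueness uses only the defining properties: the components of `π(X) Ω_ν` for `F`, the values
  -- on the dense image of `Cyl` for `I`, and the integrals of continuous functions for `μ`.
  · rintro F ⟨hF, -⟩
    funext S f ι ν
    exact hF S f ι ν (hdom.mem S f ν)
  · rintro I' ⟨⟨-, hI', -⟩, -⟩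
    funext ν
    exact LQG.isometry_unique (hI ν) (hI' ν)
  · rintro μ' ⟨hμ', -⟩
    funext ν
    exact LQG.finiteMeasure_eq fun c => (hμ' ν c).trans (hμ ν c).symm
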